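/- Let $\Sigma$ be a finite alphabet, $n\in\mathbb N$, and let $\mathcal A=(\{1,\dots,n\},\Sigma,\{M_\sigma\}_{\sigma\in\Sigma},\alpha,\omega)$ be an $n$-state weighted finite automaton over $\mathbb Q$ ($M_\sigma\in\mathbb Q^{n\times n}$, $\alpha,\omega\in\mathbb Q^n$), with weight $f_{\mathcal A}(w)=\sum_{\pi_0,\dots,\pi_T}\alpha_{\pi_0}\prod_{i=1}^T (M_{w_i})_{\pi_{i-1},\pi_i}\,\omega_{\pi_T}=\alpha^\top M_{w_1}\cdots M_{w_T}\,\omega$ for $w=w_1\cdots w_T\in\Sigma^*$. A *head* of dimension $m$ reads a sequence of vectors $x_t\in\mathbb Q^d$, keeps a matrix state $S_t=S_{t-1}A_t+b_t\in\mathbb Q^{m\times m}$ (zero before the first position) and outputs $S_tq_t$, where $q_t$ is a linear projection of $x_t$. In an *RWKV-7 head*, $A_t=\operatorname{diag}(w_t)-\lambda_t\kappa_t(a_t\odot\kappa_t)^\top$ and $b_t=v_t\tilde k_t^\top$; in a *DeltaNet head*, $A_t=I-\beta_tk_tk_t^\top$ and $b_t=\beta_tv_tk_t^\top$; the vectors $w_t,a_t,\kappa_t,v_t,\tilde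 k_t$ (resp. $k_t,v_t$) and the scalar $\lambda_t$ (resp. $\beta_t$) are linear projections of $x_t$. A *layer* consists of a multihead sublayer $x_t\mapsto x_t+O\langle y_1,\dots,y_h\rangle_t$ ($y_i$ the head outputs) followed by a feedforward sublayer $x_t\mapsto x_t+W\,\mathrm{ReLU}(Ux_t)$. An $L$-layer RWKV-7 (resp. DeltaNet) network over $\mathbb Q$ is a token embedding, followed by $L$ layers all of whose heads are RWKV-7 (resp. DeltaNet) heads, followed by a linear scalar readout $o^\top x_t$ at each position; all parameters are rational and no normalization is applied. On the word $w$ it is run on $\$w$, where $\$\notin\Sigma$ is a beginning-of-sequence token. Then: 1. There is a $4$-layer RWKV-7 network over $\mathbb Q$, depending only on $\mathcal A$, whose output, for every word $w=w_1\cdots w_T\in\Sigma^*$ and every $0\le t\le T$, at the position of $w_t$ (of $\$$ if $t=0$) equals $f_{\mathcal A}(w_1\cdots w_t)$. In particular the output at the last position is $f_{\mathcal A}(w)$. 2. The same holds with a $4$-layer DeltaNet network over $\mathbb Q$. 3. For every $P\in\mathbb Q^{n\times n}$ (in particular for every product of transition matrices $M_\sigma$) there are $2n$ overwrite matrices $G_1,\dots,G_{2n}\in\mathbb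 Q^{2n\times 2n}$ with $[x\mid s]\,G_1\cdots G_{2n}=[xP\mid xP]$ for all row vectors $x,s\in\mathbb Q^{1\times n}$. Here an overwrite matrix is an identity matrix one of whose columns, say the $j$-th, is replaced by a vector $c$ with $c_j=0$. 4. For every $P\in\mathbb Q^{n\times n}$ there are $m=8n^2+5n+1$ matrices $G_i=I-\beta_ik_ik_i^\top\in\mathbb Q^{(2n+1)\times(2n+1)}$ with $[x\mid s\mid r]\,G_1\cdots G_m=[xP\mid xP\mid 0]$ for all $x,s\in\mathbb Q^{1\times n}$ and $r\in\mathbb Q$. -/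

import Mathlib

open Matrix

/-- A weighted finite automaton over `ℚ` with state set `Fin n` and alphabet `Σ`. -/
structure WFA (Sig : Type*) (n : ℕ) where
  /-- transition matrices -/
  M : Sig → Matrix (Fin n) (Fin n) ℚ
  /-- initial weights -/
  α : Fin n → ℚ
  /-- final weights -/
  ω : Fin n → ℚ

/-- The score `f_A(w)`: the sum over all state paths `π₀, …, π_T` of
`α(π₀) · ∏ᵢ M_{wᵢ}(πᵢ₋₁, πᵢ) · ω(π_T)`. -/
def WFA.weight {Sig : Type*} {n : ℕ} (A : WFA Sig n) (w : List Sig) : ℚ :=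
  ∑ π : Fin (w.length + 1) → Fin n,
    A.α (π 0) * (∏ i : Fin w.length, A.M (w.get i) (π i.castSucc) (π i.succ)) *
      A.ω (π (Fin.last w.length))

/-- A sum over state paths is a matrix product. -/
theorem sum_paths_eq {n : ℕ} (ω : Fin n → ℚ) : ∀ (T : ℕ) (B : Fin T → Matrix (Fin n) (Fin n) ℚ)
    (v : Fin n → ℚ),
    (∑ π : Fin (T + 1) → Fin n,
      v (π 0) * (∏ i : Fin T, B i (π i.castSucc) (π i.succ)) * ω (π (Fin.last T))) =
      v ⬝ᵥ ((List.ofFn B).prod *ᵥ ω)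
  | 0, B, v => by
    rw [← (Equiv.funUnique (Fin 1) (Fin n)).symm.sum_comp]
    simp [dotProduct]
  | T + 1, B, v => by
    rw [← (Fin.consEquiv (fun _ : Fin (T + 2) => Fin n)).sum_comp, Fintype.sum_prod_type,
      List.ofFn_succ, List.prod_cons, ← Matrix.mulVec_mulVec, Matrix.dotProduct_mulVec,
      ← sum_paths_eq ω T, Finset.sum_comm]
    refine Finset.sum_congr rfl fun π _ => ?_
    simp only [Matrix.vecMul, dotProduct, Finset.sum_mul]
    refine Finset.sum_congr rfl fun j _ => ?_
    simp only [Fin.consEquiv, Equiv.coe_fn_mk, Fin.prod_univ_succ, Fin.cons_zero, Fin.cons_succ,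
      Fin.castSucc_zero, ← Fin.succ_castSucc, ← Fin.succ_last]
    ring

/-- The path form of the score agrees with the matrix form `αᵀ M_{w₁} ⋯ M_{w_T} ω`. -/
theorem WFA.weight_eq {Sig : Type*} {n : ℕ} (A : WFA Sig n) (w : List Sig) :
    A.weight w = A.α ⬝ᵥ ((w.map A.M).prod *ᵥ A.ω) := by
  have h : w.map A.M = List.ofFn fun i : Fin w.length => A.M (w.get i) := by
    conv_lhs => rw [← List.ofFn_get w, List.map_ofFn]
    rfl
  rw [h, ← sum_paths_eq]
  rfl

/-- The RWKV-7 transition matrix `diag(w) - lam • κ (a ⊙ κ)ᵀ`. -/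
def rwkvTransition {ι : Type*} [DecidableEq ι] (w a κ : ι → ℚ) (lam : ℚ) : Matrix ι ι ℚ :=
  Matrix.diagonal w - lam • Matrix.vecMulVec κ (a * κ)

/-- The DeltaNet transition matrix `I - β k kᵀ`. -/
def deltaTransition {ι : Type*} [DecidableEq ι] (β : ℚ) (k : ι → ℚ) : Matrix ι ι ℚ :=
  1 - β • Matrix.vecMulVec k k

/-- `U` is a dot-product overwrite matrix: the identity with one column `dst` replaced by a
vector `c` such that `c dst = 0`. -/
def IsOverwrite {ι : Type*} [DecidableEq ι] (U : Matrix ι ι ℚ) : Prop :=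
  ∃ (dst : ι) (c : ι → ℚ), c dst = 0 ∧ U = (1 : Matrix ι ι ℚ).updateCol dst c

/-- A linear RNN head reading vectors of dimension `d`, with an `m × m` matrix state. -/
structure LRNNHead (d m : ℕ) where
  /-- the transition matrix as a function of the current input -/
  trans : (Fin d → ℚ) → Matrix (Fin m) (Fin m) ℚ
  /-- the additive update as a function of the current input -/
  add : (Fin d → ℚ) → Matrix (Fin m) (Fin m) ℚ
  /-- the query projection -/
  Q : Matrix (Fin m) (Fin d) ℚ

/-- The state of the head after the first `t` inputs: `S ← S * A(x) + b(x)`, started at `0`. -/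
def LRNNHead.state {d m T : ℕ} (h : LRNNHead d m) (x : Fin T → Fin d → ℚ) :
    ℕ → Matrix (Fin m) (Fin m) ℚ
  | 0 => 0
  | t + 1 =>
    if ht : t < T then h.state x t * h.trans (x ⟨t, ht⟩) + h.add (x ⟨t, ht⟩) else h.state x t

/-- The head output `S_t q_t` at position `t`, where `q_t = Q x_t` and `S_t` already includes
the update at position `t`. -/
def LRNNHead.out {d m T : ℕ} (h : LRNNHead d m) (x : Fin T → Fin d → ℚ) (t : Fin T) :
    Fin m → ℚ :=
  h.state x (t + 1) *ᵥ (h.Q *ᵥ x t)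

/-- An RWKV-7 head: `A_t = diag(w_t) - λ_t κ_t (a_t ⊙ κ_t)ᵀ` and `b_t = v_t k̃_tᵀ`, where all
parameters are linear projections of the current input. -/
def LRNNHead.IsRWKV7 {d m : ℕ} (h : LRNNHead d m) : Prop :=
  ∃ (Pw Pa Pκ Pv Pk : Matrix (Fin m) (Fin d) ℚ) (pl : Fin d → ℚ), ∀ x : Fin d → ℚ,
    h.trans x = rwkvTransition (Pw *ᵥ x) (Pa *ᵥ x) (Pκ *ᵥ x) (pl ⬝ᵥ x) ∧
    h.add x = Matrix.vecMulVec (Pv *ᵥ x) (Pk *ᵥ x)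

/-- A DeltaNet head: `A_t = I - β_t k_t k_tᵀ` and `b_t = β_t v_t k_tᵀ`, where all parameters are
linear projections of the current input. -/
def LRNNHead.IsDeltaNet {d m : ℕ} (h : LRNNHead d m) : Prop :=
  ∃ (Pk Pv : Matrix (Fin m) (Fin d) ℚ) (pb : Fin d → ℚ), ∀ x : Fin d → ℚ,
    h.trans x = deltaTransition (pb ⬝ᵥ x) (Pk *ᵥ x) ∧
    h.add x = (pb ⬝ᵥ x) • Matrix.vecMulVec (Pv *ᵥ x) (Pk *ᵥ x)

/-- A layer of model dimension `d`: a multihead linear RNN sublayer followed by a two-layer ReLU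
feedforward sublayer. -/
structure LRNNLayer (d : ℕ) where
  /-- the number of heads -/
  numHeads : ℕ
  /-- the dimension of each head -/
  headDim : ℕ
  /-- the hidden width of the feedforward sublayer -/
  ffDim : ℕ
  /-- the heads -/
  head : Fin numHeads → LRNNHead d headDim
  /-- the output projection applied to the concatenated head outputs -/
  O : Matrix (Fin d) (Fin numHeads × Fin headDim) ℚ
  /-- the first feedforward matrix -/
  U : Matrix (Fin ffDim) (Fin d) ℚ
  /-- the second feedforward matrix -/
  W : Matrix (Fin d) (Fin ffDim) ℚ

/-- The multihead sublayer `x_t ↦ x_t + O ⟨y_1, …, y_h⟩`. -/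
def LRNNLayer.mix {d T : ℕ} (L : LRNNLayer d) (x : Fin T → Fin d → ℚ) : Fin T → Fin d → ℚ :=
  fun t => x t + L.O *ᵥ fun p => (L.head p.1).out x t p.2

/-- The feedforward sublayer `x ↦ x + W ReLU(U x)`. -/
def LRNNLayer.ff {d : ℕ} (L : LRNNLayer d) (x : Fin d → ℚ) : Fin d → ℚ :=
  x + L.W *ᵥ fun i => max ((L.U *ᵥ x) i) 0

/-- The layer map on sequences. -/
def LRNNLayer.run {d T : ℕ} (L : LRNNLayer d) (x : Fin T → Fin d → ℚ) : Fin T → Fin d → ℚ :=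
  fun t => L.ff (L.mix x t)

/-- A network with `ℓ` layers over the alphabet `Sig`, with an embedding of the tokens, where
`none` is the beginning-of-sequence token, and a linear scalar output. -/
structure LRNNNetwork (Sig : Type*) (ℓ : ℕ) where
  /-- the model dimension -/
  d : ℕ
  /-- the token embedding -/
  embed : Option Sig → Fin d → ℚ
  /-- the layers, in order of application -/
  layer : Fin ℓ → LRNNLayer d
  /-- the output vector -/
  o : Fin d → ℚ

/-- The token stream `$ w₁ ⋯ w_T`. -/
def tokenStream {Sig : Type*} (w : List Sig) : Fin (w.length + 1) → Option Sig :=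
  Fin.cons none fun i => some (w.get i)

/-- The scalar output at each position of `$ w₁ ⋯ w_T`: position `0` is that of `$`, and
position `t ≥ 1` is that of `w_t`. -/
def LRNNNetwork.output {Sig : Type*} {ℓ : ℕ} (N : LRNNNetwork Sig ℓ) (w : List Sig)
    (t : Fin (w.length + 1)) : ℚ :=
  N.o ⬝ᵥ (List.ofFn N.layer).foldl (fun x L => L.run x)
    (fun i => N.embed (tokenStream w i)) t

/-- All heads of the network are RWKV-7 heads. -/
def LRNNNetwork.IsRWKV7 {Sig : Type*} {ℓ : ℕ} (N : LRNNNetwork Sig ℓ) : Prop :=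
  ∀ (i : Fin ℓ) (j : Fin (N.layer i).numHeads), ((N.layer i).head j).IsRWKV7

/-- All heads of the network are DeltaNet heads. -/
def LRNNNetwork.IsDeltaNet {Sig : Type*} {ℓ : ℕ} (N : LRNNNetwork Sig ℓ) : Prop :=
  ∀ (i : Fin ℓ) (j : Fin (N.layer i).numHeads), ((N.layer i).head j).IsDeltaNet

/-! A delta-rule head changes its state by one factor `1 - β k kᵀ` per position, whereas a letter of
the automaton multiplies by an arbitrary matrix. On a doubled state `[x | s]`, however,
multiplication by any `P` is a product of `2 n` overwrites: `s` is overwritten by `x P` entry by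
entry, then copied back to `x`. Each overwrite is a product of three delta factors, so `6 n`
positions suffice for any `P`, even for the product over a whole block of letters.

The fourth layer therefore works in blocks of `L = 4 (2 n + 1)` positions. During a block it applies
the factors of the matrix of the preceding block. The factors still pending and the matrices of the
current block go into the query, so the readout is exact at every position
(`exists_simulation_layer`). All these data depend only on the position modulo `L`, the last `2 L`
letters and whether the word is empty.

Three layers supply every such function (`exists_window_layers`). A leaky sum encodes the letters.
Counting is harder: two alternating reflections compose to a plane rotation, but a rational plane
rotation of finite order has order at most 6. Instead, rotations by suitable angles serve as keys of
a delta memory whose target value makes the correction at time `t` equal to `t mod p`. By a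
Chebyshev identity this target is a linear functional of the rotations (`exists_rotation_counter`).
ReLU trapezoids then turn position plus code into indicators.

Both architectures are treated at once through `IsDeltaClass`. -/

/-! ### Activations as functions of the prefix -/

section Semantics

variable {Sig : Type*}

/-- The linear features of a sequence model whose activation after reading the prefix `w` is
`X w`. -/
def feat {d : ℕ} (X : List Sig → Fin d → ℚ) : Submodule ℚ (List Sig → ℚ) where
  carrier := {f | ∃ p : Fin d → ℚ, ∀ w, f w = p ⬝ᵥ X w}
  zero_mem' := ⟨0, fun w => by simp⟩
  add_mem' := by
    rintro f g ⟨p, hp⟩ ⟨q, hq⟩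
    exact ⟨p + q, fun w => by rw [add_dotProduct, ← hp, ← hq]; rfl⟩
  smul_mem' := by
    rintro a f ⟨p, hp⟩
    exact ⟨a • p, fun w => by rw [smul_dotProduct, ← hp]; rfl⟩

theorem mem_feat {d : ℕ} {X : List Sig → Fin d → ℚ} {f : List Sig → ℚ} :
    f ∈ feat X ↔ ∃ p : Fin d → ℚ, ∀ w, f w = p ⬝ᵥ X w := Iff.rfl

/-- If the state sequence `S` satisfies the recurrence of the head along every word, then it is
the sequence of states of the head. -/
theorem state_eq_of_recurrence {d m : ℕ} (h : LRNNHead d m) (X : List Sig → Fin d → ℚ)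
    (S : List Sig → Matrix (Fin m) (Fin m) ℚ) (h0 : S [] = h.add (X []))
    (hS : ∀ w a, S (w ++ [a]) = S w * h.trans (X (w ++ [a])) + h.add (X (w ++ [a])))
    (w : List Sig) (x : Fin (w.length + 1) → Fin d → ℚ) (hx : ∀ i, x i = X (w.take i)) :
    ∀ t : ℕ, t ≤ w.length → h.state x (t + 1) = S (w.take t)
  | 0, _ => by
    rw [LRNNHead.state, dif_pos (Nat.succ_pos _), hx]
    simp [LRNNHead.state, h0]
  | t + 1, ht => by
    rw [LRNNHead.state, dif_pos (by omega), state_eq_of_recurrence h X S h0 hS w x hx t (by omega),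
      hx, List.take_succ_eq_append_getElem (by omega), hS]

/-- The activations after the layers `Ls` on the prefix `w` are `X w`. -/
def Realizes {d : ℕ} (emb : Option Sig → Fin d → ℚ) (Ls : List (LRNNLayer d))
    (X : List Sig → Fin d → ℚ) : Prop :=
  ∀ (w : List Sig) (t : Fin (w.length + 1)),
    Ls.foldl (fun x L => L.run x) (fun i => emb (tokenStream w i)) t = X (w.take t)

/-- Computation is causal, so it is enough to guess the head states as functions of the prefix and
check one step of the recurrence. -/
theorem Realizes.append {d : ℕ} {emb : Option Sig → Fin d → ℚ} {Ls : List (LRNNLayer d)}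
    {X : List Sig → Fin d → ℚ} (hX : Realizes emb Ls X) (L : LRNNLayer d)
    (S : ∀ _ : Fin L.numHeads, List Sig → Matrix (Fin L.headDim) (Fin L.headDim) ℚ)
    (h0 : ∀ j, S j [] = (L.head j).add (X []))
    (hS : ∀ j w a, S j (w ++ [a]) =
      S j w * (L.head j).trans (X (w ++ [a])) + (L.head j).add (X (w ++ [a]))) :
    Realizes emb (Ls ++ [L]) fun w =>
      L.ff (X w + L.O *ᵥ fun p => (S p.1 w *ᵥ ((L.head p.1).Q *ᵥ X w)) p.2) := by
  intro w t
  rw [List.foldl_append, List.foldl_cons, List.foldl_nil, LRNNLayer.run, LRNNLayer.mix, hX w t]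
  congr 3
  ext p
  rw [LRNNHead.out, hX w t, state_eq_of_recurrence (L.head p.1) X (S p.1) (h0 p.1) (hS p.1) w _
    (hX w) t (by omega)]

theorem tokenStream_eq_getLast? (w : List Sig) (t : Fin (w.length + 1)) :
    tokenStream w t = (w.take t).getLast? := by
  refine Fin.cases ?_ (fun i => ?_) t
  · simp [tokenStream]
  · simp [tokenStream, List.getLast?_take]

end Semantics

/-! ### Head classes that contain the delta rule -/

/-- A class of heads that is closed under precomposition with linear maps and contains, up to
agreement on the inputs that satisfy `u = β v` and carry a constant feature, every head with
transition `1 - β k kᵀ` and update `u 1 kᵀ`. -/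
structure IsDeltaClass (K : ∀ {d m : ℕ}, LRNNHead d m → Prop) : Prop where
  comap : ∀ {d d' m : ℕ} (h : LRNNHead d m) (J : Matrix (Fin d) (Fin d') ℚ), K h →
    K (⟨fun x => h.trans (J *ᵥ x), fun x => h.add (J *ᵥ x), h.Q * J⟩ : LRNNHead d' m)
  exists_head : ∀ {d m : ℕ} (one β v u : Fin d → ℚ) (k Q : Matrix (Fin m) (Fin d) ℚ),
    ∃ h : LRNNHead d m, K h ∧ h.Q = Q ∧ ∀ x, one ⬝ᵥ x = 1 → u ⬝ᵥ x = (β ⬝ᵥ x) * (v ⬝ᵥ x) →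
      h.trans x = deltaTransition (β ⬝ᵥ x) (k *ᵥ x) ∧
      h.add x = (u ⬝ᵥ x) • vecMulVec 1 (k *ᵥ x)

theorem of_const_mulVec {d m : ℕ} (p x : Fin d → ℚ) :
    (Matrix.of fun _ : Fin m => p) *ᵥ x = (p ⬝ᵥ x) • (1 : Fin m → ℚ) := by
  ext i
  simp [mulVec]

theorem isDeltaClass_isDeltaNet : IsDeltaClass (fun {_ _} h => h.IsDeltaNet) where
  comap := by
    rintro d d' m h J ⟨Pk, Pv, pb, hx⟩
    refine ⟨Pk * J, Pv * J, pb ᵥ* J, fun x => ?_⟩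
    simpa only [← mulVec_mulVec, ← dotProduct_mulVec] using hx (J *ᵥ x)
  exists_head := by
    intro d m one β v u k Q
    refine ⟨⟨fun x => deltaTransition (β ⬝ᵥ x) (k *ᵥ x), fun x => (β ⬝ᵥ x) •
      vecMulVec ((Matrix.of fun _ : Fin m => v) *ᵥ x) (k *ᵥ x), Q⟩,
      ⟨k, Matrix.of fun _ => v, β, fun x => ⟨rfl, rfl⟩⟩, rfl, fun x _ hu => ⟨rfl, ?_⟩⟩
    simp only [of_const_mulVec, hu, smul_vecMulVec, smul_smul]

/-- With `w = a = 1`, read off the constant feature, the RWKV-7 transition is the delta transition.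
Its additive term carries no factor `β`, so the product `β v` has to be a linear feature itself. -/
theorem isDeltaClass_isRWKV7 : IsDeltaClass (fun {_ _} h => h.IsRWKV7) where
  comap := by
    rintro d d' m h J ⟨Pw, Pa, Pκ, Pv, Pk, pl, hx⟩
    refine ⟨Pw * J, Pa * J, Pκ * J, Pv * J, Pk * J, pl ᵥ* J, fun x => ?_⟩
    simpa only [← mulVec_mulVec, ← dotProduct_mulVec] using hx (J *ᵥ x)
  exists_head := by
    intro d m one β v u k Q
    let Pone : Matrix (Fin m) (Fin d) ℚ := Matrix.of fun _ => one
    refine ⟨⟨fun x => rwkvTransition (Pone *ᵥ x) (Pone *ᵥ x) (k *ᵥ x) (β ⬝ᵥ x),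
      fun x => vecMulVec ((Matrix.of fun _ : Fin m => u) *ᵥ x) (k *ᵥ x), Q⟩,
      ⟨Pone, Pone, k, _, k, β, fun x => ⟨rfl, rfl⟩⟩, rfl, fun x hone _ => ⟨?_, ?_⟩⟩
    · have h1 : Pone *ᵥ x = 1 := by rw [of_const_mulVec, hone, one_smul]
      simp only [h1, rwkvTransition, deltaTransition, one_mul]
      rw [← diagonal_one]
      rfl
    · simp only [of_const_mulVec, smul_vecMulVec]

/-! ### Layers as banks of delta-rule memories -/

section Realizable

variable {Sig : Type*} (K : ∀ {d m : ℕ}, LRNNHead d m → Prop)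

/-- There is an `ℓ`-layer body with heads in `K` whose activations are `X`. -/
def Realizable (ℓ d : ℕ) (X : List Sig → Fin d → ℚ) : Prop :=
  ∃ (emb : Option Sig → Fin d → ℚ) (Ls : List (LRNNLayer d)), Ls.length = ℓ ∧
    (∀ L ∈ Ls, ∀ j, K (L.head j)) ∧ Realizes emb Ls X

variable {K}

theorem realizable_embedding (d : ℕ) (emb : Option Sig → Fin d → ℚ) :
    Realizable K 0 d fun w => emb w.getLast? :=
  ⟨emb, [], rfl, by simp, fun w t => by simp [tokenStream_eq_getLast?]⟩

theorem Realizable.exists_network {d : ℕ} {X : List Sig → Fin d → ℚ} (hX : Realizable K 4 d X)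
    {f : List Sig → ℚ} (hf : f ∈ feat X) : ∃ N : LRNNNetwork Sig 4,
      (∀ i j, K (((N.layer i).head j))) ∧ ∀ w t, N.output w t = f (w.take t) := by
  obtain ⟨emb, Ls, hlen, hK, hR⟩ := hX
  obtain ⟨o, ho⟩ := mem_feat.1 hf
  obtain ⟨L, rfl⟩ : ∃ L : Fin 4 → LRNNLayer d, List.ofFn L = Ls := by
    exact ⟨fun i => Ls.get (i.cast hlen.symm), by
      rw [List.ofFn_congr hlen.symm]
      exact List.ofFn_get Ls⟩
  refine ⟨⟨d, emb, L, o⟩, fun i j => hK (L i) (List.mem_ofFn.2 ⟨i, rfl⟩) j, fun w t => ?_⟩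
  rw [ho, ← hR w t]
  rfl

/-- The layer that acts as `L` through the coordinate projection `J`. -/
def LRNNLayer.pad {d d' : ℕ} (L : LRNNLayer d) (J : Matrix (Fin d) (Fin d') ℚ) : LRNNLayer d' where
  numHeads := L.numHeads
  headDim := L.headDim
  ffDim := L.ffDim
  head j := ⟨fun x => (L.head j).trans (J *ᵥ x), fun x => (L.head j).add (J *ᵥ x), (L.head j).Q * J⟩
  O := Jᵀ * L.O
  U := L.U * J
  W := Jᵀ * L.W

theorem pad_state {d d' T m : ℕ} (h : LRNNHead d m) (J : Matrix (Fin d) (Fin d') ℚ)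
    (hJ : J * Jᵀ = 1) (x : Fin T → Fin d → ℚ) : ∀ t,
    LRNNHead.state (⟨fun x => h.trans (J *ᵥ x), fun x => h.add (J *ᵥ x), h.Q * J⟩ : LRNNHead d' m)
      (fun i => Jᵀ *ᵥ x i) t = h.state x t
  | 0 => rfl
  | t + 1 => by
    simp only [LRNNHead.state, pad_state h J hJ x t, mulVec_mulVec, hJ, one_mulVec]

theorem LRNNLayer.pad_run {d d' T : ℕ} (L : LRNNLayer d) (J : Matrix (Fin d) (Fin d') ℚ)
    (hJ : J * Jᵀ = 1) (x : Fin T → Fin d → ℚ) :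
    (L.pad J).run (fun i => Jᵀ *ᵥ x i) = fun i => Jᵀ *ᵥ L.run x i := by
  have hmix : (L.pad J).mix (fun i => Jᵀ *ᵥ x i) = fun i => Jᵀ *ᵥ L.mix x i := by
    funext t
    simp only [LRNNLayer.mix, mulVec_add]
    congr 1
    have hout : ∀ p : Fin L.numHeads × Fin L.headDim,
        (((L.pad J).head p.1).out (fun i => Jᵀ *ᵥ x i) t : Fin L.headDim → ℚ) p.2 =
          (L.head p.1).out x t p.2 := fun p => by
      have h1 : ((L.head p.1).Q * J) *ᵥ (Jᵀ *ᵥ x t) = (L.head p.1).Q *ᵥ x t := by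
        rw [mulVec_mulVec, Matrix.mul_assoc, hJ, Matrix.mul_one]
      have h2 := pad_state (L.head p.1) J hJ x (t + 1)
      exact congrFun (congrArg₂ (fun S q => S *ᵥ q) h2 h1) p.2
    exact (congrArg ((Jᵀ * L.O) *ᵥ ·) (funext hout)).trans (mulVec_mulVec _ _ _).symm
  funext t
  rw [LRNNLayer.run, hmix, LRNNLayer.run, LRNNLayer.ff, LRNNLayer.ff, mulVec_add]
  congr 1
  change (Jᵀ * L.W) *ᵥ (fun i => max (((L.U * J) *ᵥ (Jᵀ *ᵥ L.mix x t)) i) 0) = _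
  rw [← mulVec_mulVec, mulVec_mulVec _ (L.U * J), Matrix.mul_assoc, hJ, Matrix.mul_one]

/-- The complement of the range of `Jᵀ` stays zero, which leaves room where the residual connection
of a later layer can deposit new values unmixed. -/
theorem Realizable.pad (hK : IsDeltaClass K) {ℓ d d' : ℕ} {X : List Sig → Fin d → ℚ}
    (hX : Realizable K ℓ d X) (J : Matrix (Fin d) (Fin d') ℚ) (hJ : J * Jᵀ = 1) :
    Realizable K ℓ d' fun w => Jᵀ *ᵥ X w := by
  obtain ⟨emb, Ls, hlen, hKL, hR⟩ := hX
  refine ⟨fun a => Jᵀ *ᵥ emb a, Ls.map fun L => L.pad J, by simpa using hlen, ?_, fun w t => ?_⟩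
  · simp only [List.mem_map]
    rintro _ ⟨L, hL, rfl⟩ j
    exact hK.comap (L.head j) J (hKL L hL j)
  · have : ∀ (Ls : List (LRNNLayer d)) (x : Fin (w.length + 1) → Fin d → ℚ),
        (Ls.map fun L => L.pad J).foldl (fun x L => L.run x) (fun i => Jᵀ *ᵥ x i) =
          fun i => Jᵀ *ᵥ Ls.foldl (fun x L => L.run x) x i := by
      intro Ls
      induction Ls with
      | nil => intro x; rfl
      | cons L Ls ih =>
        intro x
        rw [List.map_cons, List.foldl_cons, LRNNLayer.pad_run L J hJ, ih, List.foldl_cons]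
    rw [this]
    exact congrArg (Jᵀ *ᵥ ·) (hR w t)

/-- The matrix that selects the coordinates `g`. -/
def selection {α γ : Type*} [DecidableEq γ] (g : α → γ) : Matrix α γ ℚ :=
  Matrix.of fun i j => if g i = j then 1 else 0

theorem selection_mulVec {α γ : Type*} [Fintype γ] [DecidableEq γ] (g : α → γ) (x : γ → ℚ) :
    selection g *ᵥ x = x ∘ g := by
  ext i
  simp [selection, mulVec, dotProduct]

theorem selection_mul_transpose {α α' γ : Type*} [Fintype γ] [DecidableEq γ] (g : α → γ)
    (g' : α' → γ) : selection g * (selection g')ᵀ = Matrix.of fun i j => if g i = g' j then 1 else 0 := by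
  ext i j
  simp [selection, mul_apply, eq_comm]

theorem selection_mul_transpose_self {α γ : Type*} [Fintype γ] [DecidableEq α] [DecidableEq γ]
    (g : α → γ) (hg : Function.Injective g) : selection g * (selection g)ᵀ = 1 := by
  rw [selection_mul_transpose]
  ext i j
  simp [one_apply, hg.eq_iff]

theorem selection_mul_transpose_of_ne {α α' γ : Type*} [Fintype γ] [DecidableEq γ]
    (g : α → γ) (g' : α' → γ) (hg : ∀ i j, g i ≠ g' j) : selection g * (selection g')ᵀ = 0 := by
  rw [selection_mul_transpose]
  ext i j
  simp [hg]

/-- Writing the same scalar into every row keeps all rows of the matrix state equal, so a head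
behaves as a single vector memory `s`. -/
theorem of_const_mul_deltaTransition {m : ℕ} (s k : Fin m → ℚ) (β v : ℚ) :
    (Matrix.of fun _ : Fin m => s) * deltaTransition β k + (β * v) • vecMulVec 1 k =
      Matrix.of fun _ : Fin m => s + (β * (v - s ⬝ᵥ k)) • k := by
  ext i j
  simp only [deltaTransition, mul_sub, mul_one, Matrix.mul_smul, mul_vecMulVec, Matrix.add_apply, Matrix.sub_apply,
    Matrix.smul_apply, vecMulVec_apply, of_apply, mulVec, Pi.add_apply, Pi.smul_apply, smul_eq_mul,
    Pi.one_apply]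
  ring

/-- One layer of delta-rule memories `s ← s + β (v - s · k) k` read out by `s · q`, followed by the
rectification of linear functionals of its input and output. -/
theorem Realizable.exists_layer_fin (hK : IsDeltaClass K) {ℓ d : ℕ} {X : List Sig → Fin d → ℚ}
    (hX : Realizable K ℓ d X) (h1 : (fun _ => 1) ∈ feat X) {H P m : ℕ}
    (β v : Fin H → List Sig → ℚ) (k q s : Fin H → List Sig → Fin (m + 1) → ℚ)
    (hβ : ∀ j, β j ∈ feat X) (hv : ∀ j, v j ∈ feat X)
    (hβv : ∀ j, (fun w => β j w * v j w) ∈ feat X)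
    (hk : ∀ j i, (fun w => k j w i) ∈ feat X) (hq : ∀ j i, (fun w => q j w i) ∈ feat X)
    (hs0 : ∀ j, s j [] = (β j [] * v j []) • k j [])
    (hs : ∀ j w a, s j (w ++ [a]) = s j w +
      (β j (w ++ [a]) * (v j (w ++ [a]) - s j w ⬝ᵥ k j (w ++ [a]))) • k j (w ++ [a]))
    (a : Fin P → List Sig → ℚ) (ha : ∀ i, a i ∈ feat X) (b : Fin P → Fin H → ℚ) :
    ∃ (d' : ℕ) (X' : List Sig → Fin d' → ℚ), Realizable K (ℓ + 1) d' X' ∧ feat X ≤ feat X' ∧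
      (∀ j, (fun w => s j w ⬝ᵥ q j w) ∈ feat X') ∧
      ∀ i, (fun w => max (a i w + ∑ j, b i j * (s j w ⬝ᵥ q j w)) 0) ∈ feat X' := by
  -- The coordinates are the old stream, one slot per head output and one per ReLU unit. The last
  -- two groups are zero before the layer.
  let e : Fin d ⊕ Fin H ⊕ Fin P ≃ Fin (Fintype.card (Fin d ⊕ Fin H ⊕ Fin P)) := Fintype.equivFin _
  let J := selection fun i : Fin d => e (Sum.inl i)
  let JH := selection fun i : Fin H => e (Sum.inr (Sum.inl i))
  let JP := selection fun i : Fin P => e (Sum.inr (Sum.inr i))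
  have hJJ : J * Jᵀ = 1 := selection_mul_transpose_self _ (e.injective.comp Sum.inl_injective)
  have hJH : J * JHᵀ = 0 := selection_mul_transpose_of_ne _ _ fun i j h => by simpa using e.injective h
  have hJP : J * JPᵀ = 0 := selection_mul_transpose_of_ne _ _ fun i j h => by simpa using e.injective h
  have hHJ : JH * Jᵀ = 0 := selection_mul_transpose_of_ne _ _ fun i j h => by simpa using e.injective h
  have hHH : JH * JHᵀ = 1 := selection_mul_transpose_self _
    (e.injective.comp (Sum.inr_injective.comp Sum.inl_injective))
  have hHP : JH * JPᵀ = 0 := selection_mul_transpose_of_ne _ _ fun i j h => by simpa using e.injective h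
  have hPJ : JP * Jᵀ = 0 := selection_mul_transpose_of_ne _ _ fun i j h => by simpa using e.injective h
  have hPH : JP * JHᵀ = 0 := selection_mul_transpose_of_ne _ _ fun i j h => by simpa using e.injective h
  have hPP : JP * JPᵀ = 1 := selection_mul_transpose_self _
    (e.injective.comp (Sum.inr_injective.comp Sum.inr_injective))
  obtain ⟨p1, hp1⟩ := mem_feat.1 h1
  choose pβ hpβ using fun j => mem_feat.1 (hβ j)
  choose pv hpv using fun j => mem_feat.1 (hv j)
  choose pu hpu using fun j => mem_feat.1 (hβv j)
  choose pk hpk using fun j i => mem_feat.1 (hk j i)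
  choose pq hpq using fun j i => mem_feat.1 (hq j i)
  choose pa hpa using fun i => mem_feat.1 (ha i)
  have hdot : ∀ (p : Fin d → ℚ) w, (p ᵥ* J) ⬝ᵥ (Jᵀ *ᵥ X w) = p ⬝ᵥ X w := fun p w => by
    rw [← dotProduct_mulVec, mulVec_mulVec, hJJ, one_mulVec]
  have hmul : ∀ (p : Matrix (Fin (m + 1)) (Fin d) ℚ) w, (p * J) *ᵥ (Jᵀ *ᵥ X w) = p *ᵥ X w :=
    fun p w => by rw [mulVec_mulVec, Matrix.mul_assoc, hJJ, Matrix.mul_one]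
  choose h hhK hhQ hh using fun j => hK.exists_head (p1 ᵥ* J) (pβ j ᵥ* J) (pv j ᵥ* J) (pu j ᵥ* J)
    (Matrix.of (pk j) * J) (Matrix.of (pq j) * J)
  have hkX : ∀ j w, Matrix.of (pk j) *ᵥ X w = k j w := fun j w => funext fun i => (hpk j i w).symm
  have hqX : ∀ j w, Matrix.of (pq j) *ᵥ X w = q j w := fun j w => funext fun i => (hpq j i w).symm
  have hhX : ∀ j w, (h j).trans (Jᵀ *ᵥ X w) = deltaTransition (β j w) (k j w) ∧
      (h j).add (Jᵀ *ᵥ X w) = (β j w * v j w) • vecMulVec 1 (k j w) := fun j w => by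
    have := hh j (Jᵀ *ᵥ X w) (by rw [hdot, ← hp1]) (by rw [hdot, hdot, hdot, ← hpβ, ← hpv, ← hpu])
    rwa [hdot, hdot, hmul, ← hpβ, ← hpu, hkX] at this
  obtain ⟨emb, Ls, hlen, hKL, hR⟩ := hX.pad hK J hJJ
  let L : LRNNLayer (Fintype.card (Fin d ⊕ Fin H ⊕ Fin P)) :=
    { numHeads := H
      headDim := m + 1
      ffDim := P
      head := h
      -- All rows of a state agree, so row `0` is read; its existence is why the head dimension is
      -- `m + 1`.
      O := JHᵀ * selection fun j : Fin H => (j, (0 : Fin (m + 1)))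
      U := Matrix.of pa * J + Matrix.of b * JH
      W := JPᵀ }
  have hR' := hR.append L (fun j w => Matrix.of fun _ => s j w)
    (fun j => by
      rw [show (L.head j) = h j from rfl, (hhX j []).2, hs0]
      ext i i'
      simp)
    (fun j w c => by
      rw [show (L.head j) = h j from rfl, (hhX j _).1, (hhX j _).2, hs]
      exact (of_const_mul_deltaTransition _ _ _ _).symm)
  let out : List Sig → Fin H → ℚ := fun w j => s j w ⬝ᵥ q j w
  let rel : List Sig → Fin P → ℚ := fun w i => max (a i w + ∑ j, b i j * (s j w ⬝ᵥ q j w)) 0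
  have hX' : ∀ w, L.ff (Jᵀ *ᵥ X w + L.O *ᵥ fun p =>
      ((Matrix.of fun _ => s p.1 w : Matrix (Fin (m + 1)) (Fin (m + 1)) ℚ) *ᵥ
        ((L.head p.1).Q *ᵥ (Jᵀ *ᵥ X w))) p.2) = Jᵀ *ᵥ X w + JHᵀ *ᵥ out w + JPᵀ *ᵥ rel w := fun w => by
    have hO : (L.O *ᵥ fun p =>
      ((Matrix.of fun _ => s p.1 w : Matrix (Fin (m + 1)) (Fin (m + 1)) ℚ) *ᵥ
        ((L.head p.1).Q *ᵥ (Jᵀ *ᵥ X w))) p.2) = JHᵀ *ᵥ out w := by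
      change (JHᵀ * selection fun j : Fin H => (j, (0 : Fin (m + 1)))) *ᵥ _ = _
      rw [← mulVec_mulVec, selection_mulVec]
      congr 1
      ext j
      change s j w ⬝ᵥ ((h j).Q *ᵥ (Jᵀ *ᵥ X w)) = _
      rw [hhQ, hmul, hqX]
    rw [hO, LRNNLayer.ff]
    congr 1
    change JPᵀ *ᵥ (fun i => max (((Matrix.of pa * J + Matrix.of b * JH) *ᵥ _) i) 0) = _
    congr 1
    ext i
    have hU : (Matrix.of pa * J + Matrix.of b * JH) *ᵥ (Jᵀ *ᵥ X w + JHᵀ *ᵥ out w) =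
        Matrix.of pa *ᵥ X w + Matrix.of b *ᵥ out w := by
      rw [mulVec_add, mulVec_mulVec, mulVec_mulVec, Matrix.add_mul, Matrix.add_mul,
        Matrix.mul_assoc, Matrix.mul_assoc, Matrix.mul_assoc, Matrix.mul_assoc, hJJ, hJH, hHJ, hHH]
      simp only [Matrix.mul_one, Matrix.mul_zero, add_zero, zero_add]
    rw [hU]
    simp only [rel, hpa]
    rfl
  refine ⟨_, fun w => Jᵀ *ᵥ X w + JHᵀ *ᵥ out w + JPᵀ *ᵥ rel w, ⟨emb, Ls ++ [L], by simp [hlen], ?_,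
    fun w t => (hR' w t).trans (hX' _)⟩, ?_, ?_, ?_⟩
  · intro L' hL' j
    rcases List.mem_append.1 hL' with h' | h'
    · exact hKL L' h' j
    · obtain rfl := List.mem_singleton.1 h'
      exact hhK j
  · rintro f ⟨p, hp⟩
    refine ⟨p ᵥ* J, fun w => ?_⟩
    rw [← dotProduct_mulVec, hp]
    simp only [mulVec_add, mulVec_mulVec, hJJ, hJH, hJP, one_mulVec, zero_mulVec, add_zero]
  · refine fun j => ⟨Pi.single j 1 ᵥ* JH, fun w => ?_⟩
    rw [← dotProduct_mulVec]
    simp only [mulVec_add, mulVec_mulVec, hHJ, hHH, hHP, one_mulVec, zero_mulVec, add_zero, zero_add]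
    simp [out]
  · refine fun j => ⟨Pi.single j 1 ᵥ* JP, fun w => ?_⟩
    rw [← dotProduct_mulVec]
    simp only [mulVec_add, mulVec_mulVec, hPJ, hPH, hPP, one_mulVec, zero_mulVec, zero_add]
    simp [rel]

/-- `Realizable.exists_layer_fin` over arbitrary finite index types. -/
theorem Realizable.exists_layer (hK : IsDeltaClass K) {ℓ d : ℕ} {X : List Sig → Fin d → ℚ}
    (hX : Realizable K ℓ d X) (h1 : (fun _ => 1) ∈ feat X) {η φ μ : Type*} [Fintype η] [Fintype φ]
    [Fintype μ] [Nonempty μ]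
    (β v : η → List Sig → ℚ) (k q s : η → List Sig → μ → ℚ)
    (hβ : ∀ j, β j ∈ feat X) (hv : ∀ j, v j ∈ feat X)
    (hβv : ∀ j, (fun w => β j w * v j w) ∈ feat X)
    (hk : ∀ j i, (fun w => k j w i) ∈ feat X) (hq : ∀ j i, (fun w => q j w i) ∈ feat X)
    (hs0 : ∀ j, s j [] = (β j [] * v j []) • k j [])
    (hs : ∀ j w a, s j (w ++ [a]) = s j w +
      (β j (w ++ [a]) * (v j (w ++ [a]) - s j w ⬝ᵥ k j (w ++ [a]))) • k j (w ++ [a]))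
    (a : φ → List Sig → ℚ) (ha : ∀ i, a i ∈ feat X) (b : φ → η → ℚ) :
    ∃ (d' : ℕ) (X' : List Sig → Fin d' → ℚ), Realizable K (ℓ + 1) d' X' ∧ feat X ≤ feat X' ∧
      (∀ j, (fun w => s j w ⬝ᵥ q j w) ∈ feat X') ∧
      ∀ i, (fun w => max (a i w + ∑ j, b i j * (s j w ⬝ᵥ q j w)) 0) ∈ feat X' := by
  obtain ⟨m, hm⟩ : ∃ m, Fintype.card μ = m + 1 := Nat.exists_eq_succ_of_ne_zero Fintype.card_ne_zero
  let eη := (Fintype.equivFin η).symm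
  let eφ := (Fintype.equivFin φ).symm
  let eμ := (Fintype.equivFinOfCardEq hm).symm
  have hdot : ∀ x y : μ → ℚ, (x ∘ eμ) ⬝ᵥ (y ∘ eμ) = x ⬝ᵥ y := fun x y =>
    comp_equiv_dotProduct_comp_equiv x y eμ
  obtain ⟨d', X', hX', hle, hout, hrel⟩ := hX.exists_layer_fin hK h1 (β ∘ eη) (v ∘ eη)
    (fun j w => k (eη j) w ∘ eμ) (fun j w => q (eη j) w ∘ eμ) (fun j w => s (eη j) w ∘ eμ)
    (fun j => hβ _) (fun j => hv _) (fun j => hβv _) (fun j i => hk _ _) (fun j i => hq _ _)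
    (fun j => by
      ext i
      simp [hs0])
    (fun j w c => by
      ext i
      simp only [hdot]
      simp [hs])
    (a ∘ eφ) (fun i => ha _) (fun i j => b (eφ i) (eη j))
  refine ⟨d', X', hX', hle, fun j => ?_, fun i => ?_⟩
  · have := hout (eη.symm j)
    simpa only [hdot, Equiv.apply_symm_apply] using this
  · have := hrel (eφ.symm i)
    simp only [hdot, Equiv.apply_symm_apply, Function.comp_apply] at this
    convert this using 4
    exact (Equiv.sum_comp eη fun j => b i j * (s j _ ⬝ᵥ q j _)).symm

end Realizable

theorem exists_ofFn_eq {α : Type*} {m : ℕ} (l : List α) (h : l.length = m) :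
    ∃ f : Fin m → α, List.ofFn f = l := by
  subst h
  exact ⟨l.get, List.ofFn_get l⟩

/-! ### Overwrites and delta factors -/

section RowOperations

variable {κ : Type*} [Fintype κ] [DecidableEq κ]

theorem vecMul_deltaTransition (β : ℚ) (k z : κ → ℚ) :
    z ᵥ* deltaTransition β k = z - (β * (z ⬝ᵥ k)) • k := by
  rw [deltaTransition, vecMul_sub, vecMul_one, vecMul_smul, vecMul_vecMulVec, smul_smul]

/-- The overwrite matrix that replaces coordinate `p.1` by the inner product with `p.2`. -/
def overwrite (p : κ × (κ → ℚ)) : Matrix κ κ ℚ := (1 : Matrix κ κ ℚ).updateCol p.1 p.2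

theorem vecMul_overwrite (p : κ × (κ → ℚ)) (z : κ → ℚ) :
    z ᵥ* overwrite p = Function.update z p.1 (z ⬝ᵥ p.2) := by
  ext k
  by_cases h : k = p.1
  · subst h
    simp [overwrite, vecMul]
  · rw [Function.update_of_ne h]
    simp [overwrite, vecMul, dotProduct, h, one_apply]

/-- The product of a list of DeltaNet transition matrices. -/
def deltaProd (l : List (ℚ × (κ → ℚ))) : Matrix κ κ ℚ :=
  (l.map fun p => deltaTransition p.1 p.2).prod

@[simp] theorem deltaProd_nil : deltaProd ([] : List (ℚ × (κ → ℚ))) = 1 := rfl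

@[simp] theorem deltaProd_cons (p : ℚ × (κ → ℚ)) (l : List (ℚ × (κ → ℚ))) :
    deltaProd (p :: l) = deltaTransition p.1 p.2 * deltaProd l := by
  simp [deltaProd]

@[simp] theorem deltaProd_append (l l' : List (ℚ × (κ → ℚ))) :
    deltaProd (l ++ l') = deltaProd l * deltaProd l' := by
  simp [deltaProd]

theorem deltaProd_replicate_zero (m : ℕ) :
    deltaProd (List.replicate m ((0 : ℚ), (0 : κ → ℚ))) = 1 := by
  simp [deltaProd, deltaTransition]

/-- An overwrite matrix is a product of three DeltaNet transition matrices. -/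
theorem exists_deltaProd_eq_overwrite (p : κ × (κ → ℚ)) (hp : p.2 p.1 = 0) :
    ∃ l : List (ℚ × (κ → ℚ)), l.length = 3 ∧ deltaProd l = overwrite p := by
  obtain ⟨d, c⟩ := p
  replace hp : c d = 0 := hp
  let e : κ → ℚ := Pi.single d 1
  let m : ℚ := c ⬝ᵥ c
  have hm : 1 + m ≠ 0 := by
    have : 0 ≤ m := Finset.sum_nonneg fun i _ => mul_self_nonneg _
    positivity
  have he : ∀ z : κ → ℚ, z ⬝ᵥ e = z d := fun z => by simp [e]
  have hec : e ⬝ᵥ c = 0 := by rw [dotProduct_comm, he, hp]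
  have hed : e d = 1 := Pi.single_eq_same d 1
  have hek : ∀ k, k ≠ d → e k = 0 := fun k hk => Pi.single_eq_of_ne hk 1
  clear_value e
  -- The first factor clears coordinate `d`. The other two keys are orthogonal, so each reads `z ⬝ᵥ
  -- c`; they differ by `(1 + m) • e`, so the parts along `c` cancel and `(z ⬝ᵥ c) • e` is added.
  refine ⟨[(1, e), (1 / (1 + m), c - e), (-1 / (1 + m), c + m • e)], rfl,
    ext_of_single_vecMul fun i => ?_⟩
  generalize (Pi.single i 1 : κ → ℚ) = z
  rw [vecMul_overwrite]
  simp only [deltaProd_cons, deltaProd_nil, mul_one, ← vecMul_vecMul]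
  simp only [vecMul_deltaTransition, sub_dotProduct, smul_dotProduct, dotProduct_sub,
    dotProduct_add, dotProduct_smul, hec, he, smul_eq_mul]
  rw [show c ⬝ᵥ c = m from rfl]
  ext k
  by_cases h : k = d
  · subst h
    simp only [Pi.sub_apply, Pi.smul_apply, Pi.add_apply, smul_eq_mul, hp, hed,
      Function.update_self]
    field_simp
    ring
  · simp only [Pi.sub_apply, Pi.smul_apply, Pi.add_apply, smul_eq_mul,
      hek k h, hed, hp, Function.update_of_ne h]
    field_simp
    ring

theorem exists_deltaProd_eq_overwrite_prod (l : List (κ × (κ → ℚ))) (hl : ∀ p ∈ l, p.2 p.1 = 0) :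
    ∃ l' : List (ℚ × (κ → ℚ)), l'.length = 3 * l.length ∧
      deltaProd l' = (l.map overwrite).prod := by
  induction l with
  | nil => exact ⟨[], rfl, rfl⟩
  | cons p l ih =>
    obtain ⟨l₁, h₁, h₁'⟩ := exists_deltaProd_eq_overwrite p (hl p List.mem_cons_self)
    obtain ⟨l₂, h₂, h₂'⟩ := ih fun q hq => hl q (List.mem_cons_of_mem _ hq)
    refine ⟨l₁ ++ l₂, ?_, ?_⟩
    · simp [h₁, h₂]
      ring
    · simp [h₁', h₂']

/-- Overwriting the coordinates `b j` one after the other with functionals `c j` that do not read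
any of them. -/
theorem vecMul_overwrite_prod {n : ℕ} (b : Fin n → κ) (hb : Function.Injective b)
    (c : Fin n → κ → ℚ) (hc : ∀ i j, c j (b i) = 0) (J : List (Fin n)) (z : κ → ℚ) :
    (∀ j, (z ᵥ* ((J.map fun j => (b j, c j)).map overwrite).prod) (b j) =
      if j ∈ J then z ⬝ᵥ c j else z (b j)) ∧
    ∀ k, k ∉ Set.range b → (z ᵥ* ((J.map fun j => (b j, c j)).map overwrite).prod) k = z k := by
  induction J generalizing z with
  | nil => simp
  | cons i J ih =>
    have hz : ∀ j, (Function.update z (b i) (z ⬝ᵥ c i)) ⬝ᵥ c j = z ⬝ᵥ c j := fun j => by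
      refine Finset.sum_congr rfl fun k _ => ?_
      by_cases h : k = b i
      · rw [h, hc, mul_zero, mul_zero]
      · rw [Function.update_of_ne h]
    obtain ⟨h1, h2⟩ := ih (Function.update z (b i) (z ⬝ᵥ c i))
    simp only [List.map_cons, List.prod_cons, ← vecMul_vecMul, vecMul_overwrite]
    refine ⟨fun j => ?_, fun k hk => ?_⟩
    · rw [h1, hz]
      by_cases hj : j ∈ J
      · simp [hj]
      · by_cases hij : j = i
        · subst hij
          simp [hj]
        · simp [hj, hij, hb.ne hij]
    · rw [h2 k hk, Function.update_of_ne]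
      rintro rfl
      exact hk ⟨i, rfl⟩

/-- Two rounds of overwrites multiply the coordinates `a` by a matrix `P`, with a copy of the
result in the coordinates `b`. -/
theorem exists_overwrite_prod {n : ℕ} (a b : Fin n → κ) (ha : Function.Injective a)
    (hb : Function.Injective b) (hab : ∀ i j, a i ≠ b j) (P : Matrix (Fin n) (Fin n) ℚ) :
    ∃ l : List (κ × (κ → ℚ)), l.length = 2 * n ∧ (∀ p ∈ l, p.2 p.1 = 0) ∧ ∀ z : κ → ℚ,
      (∀ j, (z ᵥ* (l.map overwrite).prod) (a j) = ((z ∘ a) ᵥ* P) j) ∧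
      (∀ j, (z ᵥ* (l.map overwrite).prod) (b j) = ((z ∘ a) ᵥ* P) j) ∧
      ∀ k, k ∉ Set.range a → k ∉ Set.range b → (z ᵥ* (l.map overwrite).prod) k = z k := by
  let c : Fin n → κ → ℚ := fun j => ∑ i, P i j • Pi.single (a i) 1
  let c' : Fin n → κ → ℚ := fun j => Pi.single (b j) 1
  have hc : ∀ i j, c j (b i) = 0 := fun i j => by
    simp only [c, Finset.sum_apply, Pi.smul_apply]
    exact Finset.sum_eq_zero fun k _ => by rw [Pi.single_eq_of_ne (hab k i).symm, smul_zero]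
  have hc' : ∀ i j, c' j (a i) = 0 := fun i j => Pi.single_eq_of_ne (hab i j) _
  have hzc : ∀ (z : κ → ℚ) j, z ⬝ᵥ c j = ((z ∘ a) ᵥ* P) j := fun z j => by
    simp only [c, dotProduct_sum, dotProduct_smul, dotProduct_single, vecMul, mul_one, smul_eq_mul]
    simp [dotProduct, mul_comm]
  -- The coordinates `b` collect the product while `a` still holds the input; then `a` is copied
  -- from `b`.
  refine ⟨(List.finRange n).map (fun j => (b j, c j)) ++ (List.finRange n).map (fun j => (a j, c' j)),
    by simp; ring, fun p hp => ?_, fun z => ?_⟩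
  · rcases List.mem_append.1 hp with hp | hp <;> obtain ⟨j, -, rfl⟩ := List.mem_map.1 hp
    · exact hc j j
    · exact hc' j j
  · rw [List.map_append, List.prod_append, ← vecMul_vecMul]
    obtain ⟨h1, h2⟩ := vecMul_overwrite_prod b hb c hc (List.finRange n) z
    generalize z ᵥ* (((List.finRange n).map fun j => (b j, c j)).map overwrite).prod = z' at *
    obtain ⟨h3, h4⟩ := vecMul_overwrite_prod a ha c' hc' (List.finRange n) z'
    simp only [List.mem_finRange, if_true] at h1 h3
    have hb' : ∀ j, z' ⬝ᵥ c' j = ((z ∘ a) ᵥ* P) j := fun j => by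
      simp only [c', dotProduct_single, mul_one, h1, hzc]
    refine ⟨fun j => by rw [h3, hb'], fun j => ?_, fun k hka hkb => by rw [h4 k hka, h2 k hkb]⟩
    rw [h4 _ (by rintro ⟨i, hi⟩; exact hab i j hi), h1, hzc]

end RowOperations

/-- Multiplication by `P`, with a copy, is a product of `2 n` overwrite matrices. -/
theorem exists_isOverwrite_factorization {n : ℕ} (P : Matrix (Fin n) (Fin n) ℚ) :
    ∃ G : Fin (2 * n) → Matrix (Fin n ⊕ Fin n) (Fin n ⊕ Fin n) ℚ,
      (∀ i, IsOverwrite (G i)) ∧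
      ∀ x s : Fin n → ℚ,
        Sum.elim x s ᵥ* (List.ofFn G).prod = Sum.elim (x ᵥ* P) (x ᵥ* P) := by
  obtain ⟨l, hlen, hl, h⟩ := exists_overwrite_prod (κ := Fin n ⊕ Fin n) Sum.inl Sum.inr
    Sum.inl_injective Sum.inr_injective (fun _ _ => Sum.inl_ne_inr) P
  obtain ⟨f, rfl⟩ := exists_ofFn_eq l hlen
  refine ⟨fun i => overwrite (f i), fun i => ⟨(f i).1, (f i).2, hl _ (by simp), rfl⟩,
    fun x s => ?_⟩
  obtain ⟨h1, h2, -⟩ := h (Sum.elim x s)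
  rw [List.map_ofFn] at h1 h2
  ext (j | j)
  · exact h1 j
  · exact h2 j

/-- Multiplication by `P`, with a copy, is a product of at most `6 n` DeltaNet transitions. -/
theorem exists_deltaProd_factorization {n : ℕ} (P : Matrix (Fin n) (Fin n) ℚ) (m : ℕ)
    (hm : 6 * n ≤ m) : ∃ l : List (ℚ × (Fin n ⊕ Fin n → ℚ)), l.length = m ∧ ∀ x s : Fin n → ℚ,
      Sum.elim x s ᵥ* deltaProd l = Sum.elim (x ᵥ* P) (x ᵥ* P) := by
  obtain ⟨l, hlen, hl, h⟩ := exists_overwrite_prod (κ := Fin n ⊕ Fin n) Sum.inl Sum.inr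
    Sum.inl_injective Sum.inr_injective (fun _ _ => Sum.inl_ne_inr) P
  obtain ⟨l', hlen', hl'⟩ := exists_deltaProd_eq_overwrite_prod l hl
  refine ⟨l' ++ List.replicate (m - 6 * n) (0, 0), by simp; omega, fun x s => ?_⟩
  rw [deltaProd_append, deltaProd_replicate_zero, mul_one, hl']
  obtain ⟨h1, h2, -⟩ := h (Sum.elim x s)
  ext (j | j)
  · exact h1 j
  · exact h2 j

/-- Multiplication by `P`, with a copy and with a cleared scratch coordinate, is a product of
`m` DeltaNet transitions for every `m ≥ 6 n + 1`. -/
theorem exists_deltaTransition_factorization {n : ℕ} (P : Matrix (Fin n) (Fin n) ℚ) (m : ℕ)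
    (hm : 6 * n + 1 ≤ m) : ∃ (β : Fin m → ℚ) (k : Fin m → (Fin n ⊕ Fin n ⊕ Fin 1) → ℚ),
      ∀ (x s : Fin n → ℚ) (r : Fin 1 → ℚ),
        Sum.elim x (Sum.elim s r) ᵥ* (List.ofFn fun i => deltaTransition (β i) (k i)).prod =
          Sum.elim (x ᵥ* P) (Sum.elim (x ᵥ* P) 0) := by
  obtain ⟨l, hlen, hl, h⟩ := exists_overwrite_prod (κ := Fin n ⊕ Fin n ⊕ Fin 1) Sum.inl
    (Sum.inr ∘ Sum.inl) Sum.inl_injective (Sum.inr_injective.comp Sum.inl_injective)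
    (fun _ _ => Sum.inl_ne_inr) P
  obtain ⟨l', hlen', hl'⟩ := exists_deltaProd_eq_overwrite_prod l hl
  -- One factor clears the scratch coordinate, `6 n` factors multiply by `P`, and zero factors
  -- (identities) fill up the length.
  obtain ⟨f, hf⟩ := exists_ofFn_eq (m := m) ((1, Pi.single (Sum.inr (Sum.inr 0)) 1) :: l' ++
    List.replicate (m - (6 * n + 1)) (0, 0)) (by simp; omega)
  refine ⟨fun i => (f i).1, fun i => (f i).2, fun x s r => ?_⟩
  have : (List.ofFn fun i => deltaTransition (f i).1 (f i).2).prod = deltaProd (List.ofFn f) := by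
    rw [deltaProd, List.map_ofFn]
    rfl
  rw [this, hf, deltaProd_append, deltaProd_replicate_zero, mul_one, deltaProd_cons, hl',
    ← vecMul_vecMul, vecMul_deltaTransition]
  have hz : Sum.elim x (Sum.elim s r) - ((1 : ℚ) * (Sum.elim x (Sum.elim s r) ⬝ᵥ
      Pi.single (Sum.inr (Sum.inr 0)) 1)) • Pi.single (Sum.inr (Sum.inr 0)) 1 =
      Sum.elim x (Sum.elim s 0) := by
    ext (j | j | j)
    · simp
    · simp
    · simp [Subsingleton.elim j 0]
  rw [hz]
  obtain ⟨h1, h2, h3⟩ := h (Sum.elim x (Sum.elim s 0))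
  ext (j | j | j)
  · exact h1 j
  · exact h2 j
  · exact h3 _ (by simp) (by simp)

/-! ### Rational rotations, Chebyshev weights and the modular counter -/

/-- The cosine of the angle `2 arctan y`. -/
def rotCos (y : ℚ) : ℚ := (1 - y ^ 2) / (1 + y ^ 2)

/-- The sine of the angle `2 arctan y`. -/
def rotSin (y : ℚ) : ℚ := 2 * y / (1 + y ^ 2)

theorem rotCos_sq_add_rotSin_sq (y : ℚ) : rotCos y ^ 2 + rotSin y ^ 2 = 1 := by
  have : (1 + y ^ 2) ≠ 0 := by positivity
  unfold rotCos rotSin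
  field_simp
  ring

/-- The orbit of `(1, 0)` under the plane rotation by `-2 arctan y`. -/
def rotOrbit (y : ℚ) : ℕ → Fin 2 → ℚ
  | 0 => ![1, 0]
  | t + 1 => ![rotCos y * rotOrbit y t 0 + rotSin y * rotOrbit y t 1,
      -rotSin y * rotOrbit y t 0 + rotCos y * rotOrbit y t 1]

/-- Rotations are isometries. Since the inner product depends only on the time difference, reading a
memory with such keys is a convolution. -/
theorem rotOrbit_dotProduct (y : ℚ) (s t : ℕ) :
    rotOrbit y s ⬝ᵥ rotOrbit y (s + t) = rotOrbit y t 0 := by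
  induction s with
  | zero => simp [rotOrbit, dotProduct]
  | succ s ih =>
    rw [← ih, Nat.succ_add]
    simp only [dotProduct, Fin.sum_univ_two, rotOrbit, cons_val_zero, cons_val_one]
    linear_combination (rotOrbit y s 0 * rotOrbit y (s + t) 0 +
      rotOrbit y s 1 * rotOrbit y (s + t) 1) * rotCos_sq_add_rotSin_sq y

theorem rotOrbit_add_two (y : ℚ) (t : ℕ) (j : Fin 2) :
    rotOrbit y (t + 2) j = 2 * rotCos y * rotOrbit y (t + 1) j - rotOrbit y t j := by
  fin_cases j
  · simp only [rotOrbit, cons_val_zero, cons_val_one, Fin.zero_eta]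
    linear_combination -rotOrbit y t 0 * rotCos_sq_add_rotSin_sq y
  · simp only [rotOrbit, cons_val_zero, cons_val_one, Fin.mk_one]
    linear_combination -rotOrbit y t 1 * rotCos_sq_add_rotSin_sq y

open Polynomial in
/-- The reciprocal polynomial of the rotation with cosine `c`. -/
noncomputable def rotPoly (c : ℚ) : ℚ[X] := X ^ 2 - C (2 * c) * X + 1

open Polynomial in
theorem rotPoly_monic (c : ℚ) : (rotPoly c).Monic := by
  unfold rotPoly
  monicity!

open Polynomial in
theorem natDegree_rotPoly (c : ℚ) : (rotPoly c).natDegree = 2 := by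
  unfold rotPoly
  compute_degree!

open Polynomial in
theorem rotPoly_eval (c z : ℚ) (hz : z ≠ 0) :
    (rotPoly c).eval z = 2 * z * ((1 + z ^ 2) / (2 * z) - c) := by
  simp only [rotPoly, eval_add, eval_sub, eval_mul, eval_pow, eval_X, eval_C, eval_one]
  field_simp
  ring

open Polynomial in
theorem isCoprime_rotPoly {c c' : ℚ} (h : c ≠ c') : IsCoprime (rotPoly c) (rotPoly c') := by
  have h' : 2 * (c' - c) ≠ 0 := mul_ne_zero two_ne_zero (sub_ne_zero.2 h.symm)
  refine ⟨C (1 / (2 * (c' - c))) * (2 * C c' - X), -C (1 / (2 * (c' - c))) * (2 * C c - X), ?_⟩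
  have : C (1 / (2 * (c' - c))) * (2 * (C c' - C c)) = (1 : ℚ[X]) := by
    rw [← C_sub, ← C_ofNat, ← C_mul, ← C_mul, one_div_mul_cancel h', C_1]
  simp only [rotPoly, C_mul, C_ofNat]
  linear_combination this

theorem coe_rotPoly (c : ℚ) : ((rotPoly c : Polynomial ℚ) : PowerSeries ℚ) =
    PowerSeries.X ^ 2 - PowerSeries.C (2 * c) * PowerSeries.X + 1 := by
  simp [rotPoly]

theorem rotOrbit_genFun_mul (y : ℚ) (j : Fin 2) :
    (PowerSeries.mk fun t => rotOrbit y t j) *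
      ((rotPoly (rotCos y) : Polynomial ℚ) : PowerSeries ℚ) =
      PowerSeries.C (rotOrbit y 0 j) +
        PowerSeries.C (rotOrbit y 1 j - 2 * rotCos y * rotOrbit y 0 j) * PowerSeries.X := by
  rw [coe_rotPoly]
  ext t
  rw [mul_add, mul_sub, mul_one, mul_left_comm, ← mul_assoc]
  rcases t with _ | _ | t
  · simp
  · simp [PowerSeries.coeff_mul_X_pow', mul_assoc, PowerSeries.coeff_succ_mul_X]
    ring
  · simp [PowerSeries.coeff_mul_X_pow', mul_assoc, PowerSeries.coeff_succ_mul_X, rotOrbit_add_two]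

-- For `x = (z + 1/z) / 2` this is `U_n(x) = (z^(n+1) - z^(-(n+1))) / (z - 1/z)` with denominators
-- cleared; it follows from the three-term recurrence.
open Polynomial in
theorem chebyshev_U_joukowski (z : ℚ) (hz : z ≠ 0) : ∀ n : ℕ,
    (1 - z ^ 2) * z ^ n * (Chebyshev.U ℚ n).eval ((1 + z ^ 2) / (2 * z)) = 1 - z ^ (2 * (n + 1))
  | 0 => by simp
  | 1 => by
    simp
    field_simp
    ring
  | n + 2 => by
    have h1 := chebyshev_U_joukowski z hz n
    have h2 := chebyshev_U_joukowski z hz (n + 1)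
    have h3 : 2 * ((1 + z ^ 2) / (2 * z)) * z = 1 + z ^ 2 := by field_simp
    push_cast at h2 ⊢
    rw [Chebyshev.U_add_two, eval_sub, eval_mul, eval_mul, eval_X, eval_ofNat]
    generalize (1 + z ^ 2) / (2 * z) = x at *
    linear_combination (1 + z ^ 2) * h2 - z ^ 2 * h1 +
      (1 - z ^ 2) * z ^ (n + 1) * eval x (Chebyshev.U ℚ (n + 1)) * h3

/-- The weights of the partial fraction expansion of a Chebyshev polynomial of the second kind
over the nodes `c`. -/
noncomputable def nodeWeight {n : ℕ} (c : Fin (n + 1) → ℚ) (i : Fin (n + 1)) : ℚ :=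
  (Polynomial.Chebyshev.U ℚ n).eval (c i) / ∏ j ∈ Finset.univ.erase i, (c i - c j)

open Polynomial in
theorem sum_nodeWeight_mul_prod {n : ℕ} (c : Fin (n + 1) → ℚ) (hc : Function.Injective c) (x : ℚ) :
    ∑ i, nodeWeight c i * ∏ j ∈ Finset.univ.erase i, (x - c j) = (Chebyshev.U ℚ n).eval x := by
  have h := Lagrange.eq_interpolate (s := Finset.univ) (v := c) (f := Chebyshev.U ℚ n)
    hc.injOn (by rw [Chebyshev.degree_U_natCast]; simp; norm_cast; omega)
  conv_rhs => rw [h, Lagrange.interpolate_apply, eval_finsetSum]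
  refine Finset.sum_congr rfl fun i _ => ?_
  rw [eval_mul, eval_C, Lagrange.basis, eval_prod, nodeWeight, div_mul_eq_mul_div, mul_div_assoc,
    ← Finset.prod_div_distrib]
  congr 1
  refine Finset.prod_congr rfl fun j _ => ?_
  simp [Lagrange.basisDivisor, div_eq_inv_mul]

-- Under the same substitution `rotPoly c` becomes `2 z (x - c)`, so Lagrange interpolation of `U_n`
-- at `n + 1` nodes yields the identity. The point is that the weighted sum of the fractions `(1 - X
-- ^ 2) / rotPoly (c i)` has a numerator proportional to `1 - X ^ (2 * (n + 1))`, the denominator of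
-- a periodic sequence.
open Polynomial in
theorem sum_nodeWeight_mul_rotPoly {n : ℕ} (c : Fin (n + 1) → ℚ) (hc : Function.Injective c) :
    ∑ i, C (nodeWeight c i) * ((1 - X ^ 2) * ∏ j ∈ Finset.univ.erase i, rotPoly (c j)) =
      C (2 ^ n) * (1 - X ^ (2 * (n + 1))) := by
  refine eq_of_infinite_eval_eq _ _ ((Set.Ioi_infinite (0 : ℚ)).mono fun z (hz : 0 < z) => ?_)
  simp only [Set.mem_ofPred_eq, eval_finsetSum, eval_mul, eval_C, eval_sub, eval_one, eval_pow,
    eval_X, eval_prod]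
  rw [← chebyshev_U_joukowski z hz.ne' n, ← sum_nodeWeight_mul_prod c hc, Finset.mul_sum,
    Finset.mul_sum]
  refine Finset.sum_congr rfl fun i _ => ?_
  simp_rw [rotPoly_eval _ z hz.ne']
  rw [Finset.prod_mul_distrib, Finset.prod_const, Finset.card_erase_of_mem (Finset.mem_univ _),
    Finset.card_univ, Fintype.card_fin, Nat.add_sub_cancel, mul_pow]
  ring

-- One angle is placed between each two consecutive zeros of `sin ((n + 1) θ)` on `[0, π]`. Density
-- of `ℚ` and continuity of `arctan` let the half-angle tangent be rational.
open Real in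
theorem exists_rat_between_angles (n : ℕ) (i : Fin (n + 1)) : ∃ y : ℚ,
    i * π < (n + 1) * (2 * arctan y) ∧ (n + 1) * (2 * arctan y) < (i + 1) * π := by
  have hn : (0 : ℝ) < n + 1 := by positivity
  have hi : ((i : ℕ) : ℝ) + 1 ≤ n + 1 := by exact_mod_cast i.2
  have hopen : IsOpen {y : ℝ | i * π < (n + 1) * (2 * arctan y) ∧
      (n + 1) * (2 * arctan y) < (i + 1) * π} :=
    (isOpen_lt (f := fun _ => i * π) (g := fun y : ℝ => (n + 1) * (2 * arctan y))
      (by fun_prop) (by fun_prop)).inter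
    (isOpen_lt (f := fun y : ℝ => (n + 1) * (2 * arctan y)) (g := fun _ => (i + 1) * π)
      (by fun_prop) (by fun_prop))
  have hθ : 2 * arctan (tan ((i + 1 / 2) * π / (n + 1) / 2)) = (i + 1 / 2) * π / (n + 1) := by
    rw [arctan_tan]
    · ring
    · have : 0 ≤ (i + 1 / 2) * π / (n + 1) / 2 := by positivity
      linarith [pi_pos]
    · have : (i + 1 / 2) * π / (n + 1) < π := by
        rw [div_lt_iff₀ hn]
        nlinarith [pi_pos]
      linarith
  obtain ⟨y, hy⟩ := (Rat.denseRange_cast (𝕜 := ℝ)).exists_mem_open hopen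
    ⟨tan ((i + 1 / 2) * π / (n + 1) / 2), by
      simp only [Set.mem_ofPred_eq, hθ]
      rw [mul_div_cancel₀ _ hn.ne']
      constructor <;> nlinarith [pi_pos]⟩
  exact ⟨y, hy⟩

open Real in
theorem cast_rotCos (y : ℚ) : (rotCos y : ℝ) = cos (2 * arctan y) := by
  have h : (1 + (y : ℝ) ^ 2) ≠ 0 := by positivity
  rw [cos_two_mul, cos_sq_arctan, rotCos]
  push_cast
  field_simp
  ring

-- The nodes interlace with the zeros of `U_n`. The sign of `U_n` at node `i` is that of `sin ((n +
-- 1) θ)`, namely `(-1) ^ i`, and the denominator of the weight has exactly `i` negative factors.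
-- Positivity matters because the weights become squared lengths of keys.
open Real in
theorem nodeWeight_pos {n : ℕ} (y : Fin (n + 1) → ℚ)
    (hy : ∀ i : Fin (n + 1), i * π < (n + 1) * (2 * arctan (y i)) ∧
      (n + 1) * (2 * arctan (y i)) < (i + 1) * π) :
    StrictAnti (fun i => rotCos (y i)) ∧ ∀ i, 0 < nodeWeight (fun i => rotCos (y i)) i := by
  have hn : (0 : ℝ) < n + 1 := by positivity
  have h0 : ∀ i, 0 < 2 * arctan (y i) := fun i => by
    have : 0 < (n + 1) * (2 * arctan (y i)) := lt_of_le_of_lt (by positivity) (hy i).1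
    exact pos_of_mul_pos_right this hn.le
  have hπ : ∀ i, 2 * arctan (y i) < π := fun i => by linarith [arctan_lt_pi_div_two (y i)]
  have hanti : StrictAnti (fun i => rotCos (y i)) := by
    intro i j hij
    have : (rotCos (y j) : ℝ) < rotCos (y i) := by
      rw [cast_rotCos, cast_rotCos]
      refine cos_lt_cos_of_nonneg_of_le_pi (h0 i).le (hπ j).le ?_
      have h1 : ((i : ℕ) : ℝ) + 1 ≤ (j : ℕ) := by exact_mod_cast hij
      have h2 : (n + 1) * (2 * arctan (y i)) < (n + 1) * (2 * arctan (y j)) :=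
        (hy i).2.trans_le ((mul_le_mul_of_nonneg_right h1 pi_pos.le).trans (hy j).1.le)
      exact lt_of_mul_lt_mul_left h2 hn.le
    exact_mod_cast this
  refine ⟨hanti, fun i => ?_⟩
  have hU : 0 < (-1) ^ (i : ℕ) * (Polynomial.Chebyshev.U ℚ n).eval (rotCos (y i)) := by
    have h1 := Polynomial.Chebyshev.U_real_cos (2 * arctan (y i)) n
    have h2 : (((Polynomial.Chebyshev.U ℚ n).eval (rotCos (y i)) : ℚ) : ℝ) =
        (Polynomial.Chebyshev.U ℝ n).eval (cos (2 * arctan (y i))) := by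
      rw [← cast_rotCos, ← Polynomial.Chebyshev.map_U (algebraMap ℚ ℝ), ← eq_ratCast (algebraMap ℚ ℝ),
        ← eq_ratCast (algebraMap ℚ ℝ), Polynomial.eval_map_algebraMap, Polynomial.aeval_algebraMap_apply]
      simp
    have hs : 0 < sin (2 * arctan (y i)) := sin_pos_of_pos_of_lt_pi (h0 i) (hπ i)
    have h3 : 0 < (-1) ^ (i : ℕ) * sin (((n : ℤ) + 1) * (2 * arctan (y i))) := by
      have : sin (((n : ℤ) + 1) * (2 * arctan (y i)) - (i : ℕ) * π) =
        (-1) ^ (i : ℕ) * sin (((n : ℤ) + 1) * (2 * arctan (y i))) := sin_sub_nat_mul_pi _ _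
      rw [← this]
      push_cast
      refine sin_pos_of_pos_of_lt_pi ?_ ?_ <;> nlinarith [hy i]
    rw [← h1, ← h2, ← mul_assoc] at h3
    have := pos_of_mul_pos_left h3 hs.le
    exact_mod_cast this
  have hD : 0 < (-1) ^ (i : ℕ) *
      ∏ j ∈ Finset.univ.erase i, (rotCos (y i) - rotCos (y j)) := by
    have : Finset.univ.erase i = Finset.Iio i ∪ Finset.Ioi i := by
      ext j
      simp
    rw [this, Finset.prod_union (by
      rw [Finset.disjoint_left]
      intro a ha hb
      simp only [Finset.mem_Iio, Finset.mem_Ioi] at ha hb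
      exact lt_asymm ha hb), ← mul_assoc]
    refine mul_pos ?_ (Finset.prod_pos fun j hj => sub_pos.2 (hanti (Finset.mem_Ioi.1 hj)))
    have hcard : (Finset.Iio i).card = i := by simp
    rw [← hcard, ← Finset.prod_const, ← Finset.prod_mul_distrib]
    refine Finset.prod_pos fun j hj => ?_
    have := hanti (Finset.mem_Iio.1 hj)
    simp only at this
    linarith
  rw [nodeWeight, ← mul_div_mul_left _ _ (pow_ne_zero (i : ℕ) (by norm_num : (-1 : ℚ) ≠ 0))]
  exact div_pos hU hD

open Polynomial in
/-- Partial fractions for proper quotients by a product of distinct rotation polynomials. -/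
theorem exists_partial_fractions {n : ℕ} (c : Fin (n + 1) → ℚ) (hc : Function.Injective c)
    (E : ℚ[X]) (hE : E.degree < (2 * (n + 1) : ℕ)) : ∃ a b : Fin (n + 1) → ℚ,
      E = ∑ i, (C (a i) + C (b i) * X) * ∏ j ∈ Finset.univ.erase i, rotPoly (c j) := by
  obtain ⟨q, R, hR, h⟩ := eq_quo_mul_prod_add_sum_rem_mul_prod (s := Finset.univ) E
    (g := fun i => rotPoly (c i)) (fun i _ => rotPoly_monic _)
    (fun i _ j _ hij => isCoprime_rotPoly (hc.ne hij))
  have hR2 : ∀ i, (R i).degree < 2 := fun i => by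
    have := hR i (Finset.mem_univ i)
    rwa [degree_eq_natDegree (rotPoly_monic _).ne_zero, natDegree_rotPoly] at this
  have hRlin : ∀ i, R i = C ((R i).coeff 0) + C ((R i).coeff 1) * X := fun i => by
    rw [add_comm]
    exact eq_X_add_C_of_natDegree_le_one (natDegree_le_iff_coeff_eq_zero.2 fun N hN =>
      (degree_lt_iff_coeff_zero _ 2).1 (hR2 i) N hN)
  have hmon : (∏ i, rotPoly (c i)).Monic := monic_prod_of_monic _ _ fun i _ => rotPoly_monic _
  have hdeg : (∏ i, rotPoly (c i)).degree = (2 * (n + 1) : ℕ) := by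
    rw [degree_eq_natDegree hmon.ne_zero, natDegree_prod_of_monic _ _ fun i _ => rotPoly_monic _]
    simp [natDegree_rotPoly, mul_comm]
  -- The product of the denominators has degree `2 (n + 1)`, which exceeds the degree of `E` and of
  -- every remainder term.
  have hq : q = 0 := by
    by_contra hq
    have h1 : (∏ i, rotPoly (c i)).degree ≤ (q * ∏ i, rotPoly (c i)).degree := by
      rw [mul_comm]
      exact degree_le_mul_left _ hq
    have h2 : (q * ∏ i, rotPoly (c i)).degree < (2 * (n + 1) : ℕ) := by
      rw [← sub_eq_iff_eq_add.2 h]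
      refine (degree_sub_le _ _).trans_lt (max_lt hE ?_)
      refine (degree_sum_le _ _).trans_lt ((Finset.sup_lt_iff (WithBot.bot_lt_coe _)).2 fun i _ => ?_)
      have h3 : (R i * ∏ j ∈ Finset.univ.erase i, rotPoly (c j)).degree <
          (rotPoly (c i) * ∏ j ∈ Finset.univ.erase i, rotPoly (c j)).degree := by
        have hne : ∏ j ∈ Finset.univ.erase i, rotPoly (c j) ≠ 0 :=
          (monic_prod_of_monic _ _ fun j _ => rotPoly_monic _).ne_zero
        rw [degree_mul, degree_mul]
        refine WithBot.add_lt_add_right (by rwa [Ne, degree_eq_bot]) (hR i (Finset.mem_univ i))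
      rwa [Finset.mul_prod_erase _ (fun i => rotPoly (c i)) (Finset.mem_univ i), hdeg] at h3
    rw [hdeg] at h1
    exact absurd (h1.trans_lt h2) (lt_irrefl _)
  refine ⟨fun i => (R i).coeff 0, fun i => (R i).coeff 1, ?_⟩
  rw [hq, zero_mul, zero_add] at h
  rw [h]
  exact Finset.sum_congr rfl fun i _ => by rw [← hRlin i]

/-- The counter modulo `p` as a power series. -/
theorem exists_modCounter_poly (p : ℕ) : ∃ E : Polynomial ℚ, E.degree < (p : ℕ) ∧
    (PowerSeries.mk fun t => ((t % p : ℕ) : ℚ)) * (1 - PowerSeries.X ^ p) = (E : PowerSeries ℚ) := by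
  refine ⟨∑ a ∈ Finset.range p, Polynomial.monomial a (a : ℚ), ?_, ?_⟩
  · refine (Polynomial.degree_sum_le _ _).trans_lt
      ((Finset.sup_lt_iff (WithBot.bot_lt_coe _)).2 fun a ha => ?_)
    exact (Polynomial.degree_monomial_le _ _).trans_lt (by exact_mod_cast Finset.mem_range.1 ha)
  · ext t
    rw [mul_sub, mul_one, map_sub, PowerSeries.coeff_mk, PowerSeries.coeff_mul_X_pow',
      Polynomial.coeff_coe, Polynomial.finsetSum_coeff]
    simp only [Polynomial.coeff_monomial, Finset.sum_ite_eq', Finset.mem_range, PowerSeries.coeff_mk]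
    by_cases h : t < p
    · rw [if_neg (by omega), if_pos h, Nat.mod_eq_of_lt h, sub_zero]
    · rw [if_pos (by omega), if_neg h, ← Nat.mod_eq_sub_mod (by omega), sub_self]

/-- A delta-rule memory whose keys are weighted sums of rational rotations can count modulo
`2 (n + 1)` when it is driven by a linear functional of its keys. -/
theorem exists_rotation_counter (n : ℕ) : ∃ (y w μ ν : Fin (n + 1) → ℚ), (∀ i, 0 < w i) ∧
    ∀ t : ℕ, (∑ i, w i) / 2 * ((t % (2 * (n + 1)) : ℕ) : ℚ) +
      ∑ s ∈ Finset.range t, ((s % (2 * (n + 1)) : ℕ) : ℚ) * ∑ i, w i * rotOrbit (y i) (t - s) 0 =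
      ∑ i, (μ i * rotOrbit (y i) t 0 + ν i * rotOrbit (y i) t 1) := by
  choose y hy using exists_rat_between_angles n
  obtain ⟨hanti, hw⟩ := nodeWeight_pos y hy
  set c : Fin (n + 1) → ℚ := fun i => rotCos (y i) with hc
  set w := nodeWeight c with hwdef
  have hy0 : ∀ i, rotSin (y i) ≠ 0 := fun i => by
    have h1 : 0 < (n + 1) * (2 * Real.arctan (y i)) :=
      lt_of_le_of_lt (by positivity) (hy i).1
    have h2 : 0 < 2 * Real.arctan (y i) := pos_of_mul_pos_right h1 (by positivity)
    have h3 : 0 < Real.arctan (y i) := by linarith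
    have h4 : (0 : ℝ) < y i := Real.arctan_pos.1 h3
    have h5 : 0 < y i := by exact_mod_cast h4
    unfold rotSin
    positivity
  obtain ⟨E, hE, hEmul⟩ := exists_modCounter_poly (2 * (n + 1))
  obtain ⟨a, b, hab⟩ := exists_partial_fractions c hanti.injective E hE
  have hid := congrArg (Polynomial.coeToPowerSeries.ringHom (R := ℚ))
    (sum_nodeWeight_mul_rotPoly c hanti.injective)
  have habs := congrArg (Polynomial.coeToPowerSeries.ringHom (R := ℚ)) hab
  simp only [map_sum, map_mul, map_prod, map_sub, map_add, map_one, map_pow,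
    Polynomial.coeToPowerSeries.ringHom_apply, Polynomial.coe_C, Polynomial.coe_X] at hid habs
  let A : Fin (n + 1) → PowerSeries ℚ := fun i => PowerSeries.mk fun t => rotOrbit (y i) t 0
  let B : Fin (n + 1) → PowerSeries ℚ := fun i => PowerSeries.mk fun t => rotOrbit (y i) t 1
  let q : Fin (n + 1) → PowerSeries ℚ := fun i => ((rotPoly (c i) : Polynomial ℚ) : PowerSeries ℚ)
  let e : PowerSeries ℚ := PowerSeries.mk fun t => ((t % (2 * (n + 1)) : ℕ) : ℚ)
  have hA : ∀ i, A i * q i = 1 - PowerSeries.C (c i) * PowerSeries.X := fun i => by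
    have := rotOrbit_genFun_mul (y i) 0
    simp only [rotOrbit, cons_val_zero, cons_val_one, mul_one, mul_zero, add_zero] at this
    refine this.trans ?_
    rw [show rotCos (y i) - 2 * rotCos (y i) = -c i by simp only [hc]; ring]
    simp [sub_eq_add_neg]
  have hB : ∀ i, B i * q i = -PowerSeries.C (rotSin (y i)) * PowerSeries.X := fun i => by
    have := rotOrbit_genFun_mul (y i) 1
    simp only [rotOrbit, cons_val_zero, cons_val_one, mul_one, mul_zero, add_zero] at this
    refine this.trans ?_
    simp
  let κ : ℚ := 2 ^ n / 2
  let μ : Fin (n + 1) → ℚ := fun i => κ * a i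
  let ν : Fin (n + 1) → ℚ := fun i => -κ * (b i + c i * a i) / rotSin (y i)
  have hμν : ∀ i, (PowerSeries.C (μ i) * A i + PowerSeries.C (ν i) * B i) * q i =
      PowerSeries.C κ * (PowerSeries.C (a i) + PowerSeries.C (b i) * PowerSeries.X) := fun i => by
    have h1 : ν i * rotSin (y i) = -κ * (b i + c i * a i) := div_mul_cancel₀ _ (hy0 i)
    have h2 := congrArg (PowerSeries.C (R := ℚ)) h1
    have h3 : PowerSeries.C (μ i) = PowerSeries.C κ * PowerSeries.C (a i) := map_mul _ _ _
    simp only [map_mul, map_neg, map_add] at h2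
    rw [h3]
    linear_combination PowerSeries.C κ * PowerSeries.C (a i) * hA i +
      PowerSeries.C (ν i) * hB i - PowerSeries.X * h2
  have hprod : ∀ i, ∏ j, q j = q i * ∏ j ∈ Finset.univ.erase i, q j := fun i =>
    (Finset.mul_prod_erase _ _ (Finset.mem_univ i)).symm
  have hhalf : PowerSeries.C (1 / 2 : ℚ) + PowerSeries.C (1 / 2 : ℚ) = 1 := by
    rw [← map_add]
    norm_num
  -- Halving the constant term of the cosine series produces the numerator `1 - X ^ 2` required by
  -- the Chebyshev identity. It corresponds to the coefficient `(∑ i, w i) / 2` of the current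
  -- count.
  have hHq : ∀ i, (A i - PowerSeries.C (1 / 2 : ℚ)) * q i =
      PowerSeries.C (1 / 2 : ℚ) * (1 - PowerSeries.X ^ 2) := fun i => by
    have hq : q i = PowerSeries.X ^ 2 - PowerSeries.C (2 * c i) * PowerSeries.X + 1 :=
      coe_rotPoly _
    have h2 : PowerSeries.C (2 * c i) = 2 * PowerSeries.C (c i) := by
      rw [map_mul, map_ofNat]
    have h3 := hA i
    rw [h2] at hq
    rw [hq] at h3 ⊢
    linear_combination h3 + (PowerSeries.C (c i) * PowerSeries.X - 1) * hhalf
  -- The first factor is `κ (1 - X ^ p) / ∏ q` and `e = E / (1 - X ^ p)` with `p = 2 (n + 1)`. The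
  -- periodic denominator cancels, and the partial fractions of `κ E / ∏ q` are combinations of the
  -- series `A i` and `B i`.
  have hmain : (∑ i, PowerSeries.C (w i) * (A i - PowerSeries.C (1 / 2 : ℚ))) * e =
      ∑ i, (PowerSeries.C (μ i) * A i + PowerSeries.C (ν i) * B i) := by
    have hP : ∏ j, q j ≠ 0 := Finset.prod_ne_zero_iff.2 fun j _ => by
      simpa [q] using (rotPoly_monic (c j)).ne_zero
    refine mul_right_cancel₀ hP ?_
    have h1 : (∑ i, PowerSeries.C (w i) * (A i - PowerSeries.C (1 / 2 : ℚ))) * ∏ j, q j =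
        PowerSeries.C κ * (1 - PowerSeries.X ^ (2 * (n + 1))) := by
      have hκ : PowerSeries.C κ = PowerSeries.C (1 / 2 : ℚ) * PowerSeries.C 2 ^ n := by
        rw [← map_pow, ← map_mul]
        congr 1
        simp only [κ]
        ring
      rw [hκ, mul_assoc, ← hid, Finset.sum_mul, Finset.mul_sum]
      refine Finset.sum_congr rfl fun i _ => ?_
      rw [hprod i]
      linear_combination PowerSeries.C (w i) * (∏ j ∈ Finset.univ.erase i, q j) * hHq i
    have h2 : (∑ i, (PowerSeries.C (μ i) * A i + PowerSeries.C (ν i) * B i)) * ∏ j, q j =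
        PowerSeries.C κ * (E : PowerSeries ℚ) := by
      rw [habs, Finset.sum_mul, Finset.mul_sum]
      refine Finset.sum_congr rfl fun i _ => ?_
      rw [hprod i]
      linear_combination (∏ j ∈ Finset.univ.erase i, q j) * hμν i
    rw [h2, ← hEmul]
    linear_combination e * h1
  refine ⟨y, w, μ, ν, hw, fun t => ?_⟩
  have ht := congrArg (PowerSeries.coeff t) hmain
  rw [mul_comm, PowerSeries.coeff_mul, Finset.Nat.sum_antidiagonal_eq_sum_range_succ_mk,
    Finset.sum_range_succ] at ht
  simp only [map_sum, map_add, map_sub, PowerSeries.coeff_C_mul, e, A, B, PowerSeries.coeff_mk,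
    Nat.sub_self, PowerSeries.coeff_C, if_true] at ht
  rw [← ht, add_comm]
  congr 1
  · refine Finset.sum_congr rfl fun s hs => ?_
    rw [if_neg (by have := Finset.mem_range.1 hs; omega)]
    simp
  · rw [mul_comm, Finset.sum_div]
    congr 1
    refine Finset.sum_congr rfl fun i _ => ?_
    simp only [rotOrbit, cons_val_zero]
    ring

/-! ### The first three layers: parity, rotations, counter -/

section PositionalLayers

variable {Sig : Type*} {K : ∀ {d m : ℕ}, LRNNHead d m → Prop}

/-- The base-`B` expansion of a word, the last letter being the leading digit. -/
def wordCode (B : ℚ) (dig : Sig → ℚ) (w : List Sig) : ℚ := w.foldl (fun u a => u / B + dig a) 0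

@[simp] theorem wordCode_nil (B : ℚ) (dig : Sig → ℚ) : wordCode B dig [] = 0 := rfl

@[simp] theorem wordCode_concat (B : ℚ) (dig : Sig → ℚ) (w : List Sig) (a : Sig) :
    wordCode B dig (w ++ [a]) = wordCode B dig w / B + dig a := by
  simp [wordCode]

/-- One layer computes the parity of the position and the code of the prefix. -/
theorem exists_parity_layer (hK : IsDeltaClass K) (B : ℚ) (hB : 1 < B) (dig : Sig → ℚ) :
    ∃ (d : ℕ) (X : List Sig → Fin d → ℚ), Realizable K 1 d X ∧ (fun _ => 1) ∈ feat X ∧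
      (fun w : List Sig => if w.length = 0 then 1 else 0) ∈ feat X ∧
      (fun w : List Sig => (-1) ^ w.length) ∈ feat X ∧ wordCode B dig ∈ feat X := by
  let X : List Sig → Fin 3 → ℚ := fun w => (w.getLast?).elim ![1, 1, 0] fun a => ![1, 0, dig a]
  have hX : Realizable K 0 3 X :=
    realizable_embedding 3 fun o : Option Sig => o.elim ![1, 1, 0] fun a => ![1, 0, dig a]
  have hnil : X [] = ![1, 1, 0] := rfl
  have hconcat : ∀ w a, X (w ++ [a]) = ![1, 0, dig a] := fun w a => by simp [X]
  have hcoord : ∀ i, (fun w => X w i) ∈ feat X := fun i => ⟨Pi.single i 1, fun w => by simp⟩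
  have h1 : (fun _ => 1) ∈ feat X := by
    convert hcoord 0 using 2 with w
    induction w using List.reverseRecOn with
    | nil => simp [hnil]
    | append_singleton w a => simp [hconcat]
  have hstart : (fun w : List Sig => if w.length = 0 then 1 else 0) ∈ feat X := by
    convert hcoord 1 using 2 with w
    induction w using List.reverseRecOn with
    | nil => simp [hnil]
    | append_singleton w a => simp [hconcat]
  have hconst : ∀ c : ℚ, (fun _ => c) ∈ feat X := fun c => by
    convert (feat X).smul_mem c h1 using 1
    ext w
    simp
  have hB0 : B ≠ 0 := by positivity
  have hB2 : B - 1 ≠ 0 := sub_ne_zero.2 hB.ne'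
  have hB1 : 1 - 1 / B ≠ 0 := by
    rw [sub_ne_zero, Ne, eq_div_iff hB0, one_mul]
    exact hB.ne'
  -- Gain `2` with key `1` flips the sign at every step, after value `1 / 2` has written `1` at the
  -- start. Gain `1 - 1 / B` divides the memory by `B`, and the value is rescaled so that exactly
  -- the digit is added.
  obtain ⟨d, X', hX', hle, hout, -⟩ := hX.exists_layer hK h1 (η := Bool) (φ := Empty) (μ := Unit)
    (fun b _ => bif b then 2 else 1 - 1 / B)
    (fun b w => bif b then 1 / 2 * X w 1 else 1 / (1 - 1 / B) * X w 2)
    (fun _ _ _ => 1) (fun _ _ _ => 1)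
    (fun b w _ => bif b then (-1) ^ w.length else wordCode B dig w)
    (fun b => by cases b <;> exact hconst _)
    (fun b => by cases b <;> exact (feat X).smul_mem _ (hcoord _))
    (fun b => by
      cases b
      · convert hcoord 2 using 2 with w
        simp only [cond_false]
        field_simp
      · convert hcoord 1 using 2 with w
        simp only [cond_true]
        field_simp)
    (fun _ _ => h1) (fun _ _ => h1)
    (fun b => by
      ext
      cases b <;> simp [hnil])
    (fun b w a => by
      ext
      cases b
      · simp only [cond_false, wordCode_concat, hconcat, dotProduct, Finset.univ_unique,
          Finset.sum_singleton, Pi.add_apply, Pi.smul_apply, smul_eq_mul, mul_one]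
        simp only [cons_val]
        field_simp
        ring
      · simp [hconcat, pow_succ, dotProduct]
        ring)
    Empty.elim (fun i => i.elim) (fun i => i.elim)
  refine ⟨d, X', hX', hle h1, hle hstart, ?_, ?_⟩
  · simpa [dotProduct] using hout true
  · simpa [dotProduct] using hout false

/-- The image of a plane vector under the reflection along `(1, y)`. -/
def reflectAlong (y : ℚ) (f : Fin 2 → ℚ) : Fin 2 → ℚ :=
  ![-rotCos y * f 0 - rotSin y * f 1, -rotSin y * f 0 + rotCos y * f 1]

theorem even_indicator_mem_feat {d : ℕ} {X : List Sig → Fin d → ℚ} (h1 : (fun _ => 1) ∈ feat X)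
    (hpar : (fun w : List Sig => (-1) ^ w.length) ∈ feat X) (a b : ℚ) :
    (fun w : List Sig => if w.length % 2 = 0 then a else b) ∈ feat X := by
  convert (feat X).add_mem ((feat X).smul_mem ((a + b) / 2) h1)
    ((feat X).smul_mem ((a - b) / 2) hpar) using 1
  ext w
  rcases Nat.even_or_odd w.length with h | h
  · simp only [Pi.add_apply, Pi.smul_apply, smul_eq_mul, h.neg_one_pow, Nat.even_iff.1 h, if_true]
    ring
  · simp only [Pi.add_apply, Pi.smul_apply, smul_eq_mul, h.neg_one_pow, Nat.odd_iff.1 h,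
      one_ne_zero, if_false]
    ring

/-- Given the parity of the position, one layer computes any finite set of plane rotations that
advance every second position. -/
theorem exists_rotation_layer (hK : IsDeltaClass K) {ℓ d : ℕ} {X : List Sig → Fin d → ℚ}
    (hX : Realizable K ℓ d X) (h1 : (fun _ => 1) ∈ feat X)
    (hstart : (fun w : List Sig => if w.length = 0 then 1 else 0) ∈ feat X)
    (hpar : (fun w : List Sig => (-1) ^ w.length) ∈ feat X) {r : ℕ} (y : Fin r → ℚ) :
    ∃ (d' : ℕ) (X' : List Sig → Fin d' → ℚ), Realizable K (ℓ + 1) d' X' ∧ feat X ≤ feat X' ∧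
      ∀ i j, (fun w => rotOrbit (y i) (w.length / 2) j) ∈ feat X' ∧
        (fun w => if w.length % 2 = 0 then rotOrbit (y i) (w.length / 2) j else 0) ∈ feat X' := by
  have hind := even_indicator_mem_feat h1 hpar
  have hy : ∀ i, 1 + y i ^ 2 ≠ 0 := fun i => by positivity
  obtain ⟨d', X', hX', hle, hout, -⟩ := hX.exists_layer hK h1 (η := Fin r × Fin 2 × Bool)
    (φ := Empty) (μ := Fin 2)
    -- The gain `2 / |k|²` makes each transition a reflection, along `(1, 0)` at even and `(1, y)`
    -- at odd positions. At the start the gain is lowered to `1`, so that value `1` writes `(1, 0)`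
    -- into the empty memory.
    (fun p w => (if w.length % 2 = 0 then 2 else 2 / (1 + y p.1 ^ 2)) -
      if w.length = 0 then 1 else 0)
    (fun _ w => if w.length = 0 then 1 else 0)
    (fun p w => ![1, if w.length % 2 = 0 then 0 else y p.1])
    -- At odd positions the state is the reflected orbit: the query either undoes the reflection or
    -- vanishes. The vanishing variant supplies the product of the orbit with the parity indicator,
    -- needed as a linear feature.
    (fun p w j => if w.length % 2 = 0 then (Pi.single p.2.1 1 : Fin 2 → ℚ) j else
      bif p.2.2 then reflectAlong (y p.1) (Pi.single p.2.1 1) j else 0)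
    (fun p w => if w.length % 2 = 0 then rotOrbit (y p.1) (w.length / 2) else
      reflectAlong (y p.1) (rotOrbit (y p.1) (w.length / 2)))
    (fun p => (feat X).sub_mem (hind _ _) hstart)
    (fun _ => hstart)
    (fun p => by
      convert hstart using 2 with w
      by_cases h : w.length = 0
      · simp [h]
        norm_num
      · simp [h])
    (fun p j => by
      fin_cases j
      · exact h1
      · exact hind _ _)
    (fun p j => hind _ _)
    (fun p => by
      refine (if_pos rfl).trans ?_
      ext j
      fin_cases j <;> norm_num [rotOrbit])
    (fun p w a => by
      have hlen : (w ++ [a]).length = w.length + 1 := by simp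
      rw [hlen]
      rcases Nat.mod_two_eq_zero_or_one w.length with h | h
      · have h2 : (w.length + 1) % 2 = 1 := by omega
        have h3 : (w.length + 1) / 2 = w.length / 2 := by omega
        simp only [h, h2, h3, one_ne_zero, if_true, if_false, Nat.succ_ne_zero, sub_zero, zero_sub]
        generalize rotOrbit (y p.1) (w.length / 2) = f
        have := hy p.1
        ext j
        fin_cases j
        · simp [reflectAlong, rotCos, rotSin, dotProduct, Fin.sum_univ_two]
          field_simp
          ring
        · simp [reflectAlong, rotCos, rotSin, dotProduct, Fin.sum_univ_two]
          field_simp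
          ring
      · have h2 : (w.length + 1) % 2 = 0 := by omega
        have h3 : (w.length + 1) / 2 = w.length / 2 + 1 := by omega
        simp only [h, h2, h3, one_ne_zero, if_true, if_false, Nat.succ_ne_zero, sub_zero, zero_sub,
          rotOrbit]
        generalize rotOrbit (y p.1) (w.length / 2) = f
        ext j
        fin_cases j
        · simp [reflectAlong, dotProduct, Fin.sum_univ_two]
          ring
        · simp [reflectAlong, dotProduct, Fin.sum_univ_two])
    Empty.elim (fun i => i.elim) (fun i => i.elim)
  refine ⟨d', X', hX', hle, fun i j => ⟨?_, ?_⟩⟩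
  · convert hout (i, j, true) using 2 with w
    by_cases h : w.length % 2 = 0
    · simp [h]
    · simp only [h, if_false, cond_true]
      generalize rotOrbit (y i) (w.length / 2) = f
      have := rotCos_sq_add_rotSin_sq (y i)
      fin_cases j
      · simp [reflectAlong, dotProduct, Fin.sum_univ_two]
        linear_combination -f 0 * this
      · simp [reflectAlong, dotProduct, Fin.sum_univ_two]
        linear_combination -f 1 * this
  · convert hout (i, j, false) using 2 with w
    by_cases h : w.length % 2 = 0
    · simp [h]
    · simp [h]

/-- Four squares are applied to numerator times denominator. A positive rational weight need not be
a square, so a key contains four scaled copies of each orbit. -/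
theorem exists_sum_four_sq (w : ℚ) (hw : 0 < w) : ∃ a : Fin 4 → ℚ, ∑ l, a l * a l = w := by
  obtain ⟨a, b, c, d, h⟩ := Nat.sum_four_squares (w.num.toNat * w.den)
  have hden : (w.den : ℚ) ≠ 0 := by exact_mod_cast w.den_nz
  have hnum : ((w.num.toNat : ℕ) : ℚ) = w * w.den := by
    rw [Rat.mul_den_eq_num]
    exact_mod_cast Int.toNat_of_nonneg (Rat.num_nonneg.2 hw.le)
  refine ⟨![a / w.den, b / w.den, c / w.den, d / w.den], ?_⟩
  have h' : (a : ℚ) ^ 2 + b ^ 2 + c ^ 2 + d ^ 2 = w * w.den * w.den := by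
    rw [← hnum]
    exact_mod_cast h
  simp only [Fin.sum_univ_four, cons_val]
  field_simp
  linear_combination h'

/-- Three layers compute every threshold of a combination of the position modulo `4 (n + 1)` and
the code of the prefix. -/
theorem exists_counter_layers (hK : IsDeltaClass K) (n : ℕ) (B : ℚ) (hB : 1 < B) (dig : Sig → ℚ)
    (D : ℚ) {φ : Type*} [Fintype φ] (θ : φ → ℚ) :
    ∃ (d : ℕ) (X : List Sig → Fin d → ℚ), Realizable K 3 d X ∧ (fun _ => 1) ∈ feat X ∧
      ∀ i, (fun w : List Sig => max (D * ((w.length % (4 * (n + 1)) : ℕ) : ℚ) +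
        wordCode B dig w - θ i) 0) ∈ feat X := by
  obtain ⟨y, wt, μ, ν, hwt, hcount⟩ := exists_rotation_counter n
  choose α hα using fun i => exists_sum_four_sq (wt i) (hwt i)
  obtain ⟨d₁, X₁, hX₁, h1, hstart, hpar, hcode⟩ := exists_parity_layer hK B hB dig
  obtain ⟨d₂, X₂, hX₂, hle, hrot⟩ := exists_rotation_layer hK hX₁ h1 hstart hpar y
  replace h1 := hle h1
  replace hcode := hle hcode
  replace hpar := hle hpar
  set g : ℚ := ∑ i, wt i with hg
  have hg0 : g ≠ 0 := (Finset.sum_pos (fun i _ => hwt i) Finset.univ_nonempty).ne'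
  let e : ℕ → ℚ := fun t => ((t % (2 * (n + 1)) : ℕ) : ℚ)
  let key : ℕ → Fin (n + 1) × Fin 4 × Fin 2 → ℚ := fun t p => α p.1 p.2.1 * rotOrbit (y p.1) t p.2.2
  let val : ℕ → ℚ := fun t => ∑ i, (μ i * rotOrbit (y i) t 0 + ν i * rotOrbit (y i) t 1)
  have hkey : ∀ s t, s ≤ t → key s ⬝ᵥ key t = ∑ i, wt i * rotOrbit (y i) (t - s) 0 := by
    intro s t hst
    simp only [dotProduct, Fintype.sum_prod_type, key]
    refine Finset.sum_congr rfl fun i _ => ?_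
    have h := rotOrbit_dotProduct (y i) s (t - s)
    rw [Nat.add_sub_cancel' hst] at h
    rw [← h, ← hα i, Finset.sum_mul]
    refine Finset.sum_congr rfl fun l _ => ?_
    rw [dotProduct, Finset.mul_sum]
    refine Finset.sum_congr rfl fun j _ => ?_
    ring
  have hkey0 : ∀ t, key t ⬝ᵥ key t = g := fun t => by
    rw [hkey t t le_rfl]
    simp [rotOrbit, hg]
  let st : ℕ → Fin (n + 1) × Fin 4 × Fin 2 → ℚ := fun t => ∑ s ∈ Finset.range t, e s • key s
  have hst : ∀ t, st t ⬝ᵥ key t = val t - g / 2 * e t := fun t => by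
    simp only [st, sum_dotProduct, smul_dotProduct, smul_eq_mul]
    rw [eq_sub_iff_add_eq, add_comm]
    refine Eq.trans ?_ (hcount t)
    congr 1
    exact Finset.sum_congr rfl fun s hs => by rw [hkey s t (Finset.mem_range.1 hs).le]
  -- The prediction error is `g / 2 * e t`, so gain `2 / g` writes the key with coefficient exactly
  -- `e t`.
  have hstep : ∀ t, st t + (2 / g * (val t - st t ⬝ᵥ key t)) • key t = st (t + 1) := fun t => by
    rw [hst]
    simp only [st, Finset.sum_range_succ]
    congr 2
    field_simp
    ring
  have hval : (fun w : List Sig => val (w.length / 2)) ∈ feat X₂ := by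
    have : (fun w : List Sig => val (w.length / 2)) =
        ∑ i, (μ i • (fun w => rotOrbit (y i) (w.length / 2) 0) +
          ν i • fun w : List Sig => rotOrbit (y i) (w.length / 2) 1) := by
      ext w
      simp [val]
    rw [this]
    exact (feat X₂).sum_mem fun i _ => (feat X₂).add_mem ((feat X₂).smul_mem _ (hrot i 0).1)
      ((feat X₂).smul_mem _ (hrot i 1).1)
  have hval' : (fun w : List Sig => (if w.length % 2 = 0 then 2 / g else 0) * val (w.length / 2)) ∈
      feat X₂ := by
    have : (fun w : List Sig => (if w.length % 2 = 0 then 2 / g else 0) * val (w.length / 2)) =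
        (2 / g) • ∑ i, (μ i • (fun w : List Sig =>
            if w.length % 2 = 0 then rotOrbit (y i) (w.length / 2) 0 else 0) +
          ν i • fun w : List Sig =>
            if w.length % 2 = 0 then rotOrbit (y i) (w.length / 2) 1 else 0) := by
      ext w
      by_cases h : w.length % 2 = 0 <;> simp [val, h]
    rw [this]
    exact (feat X₂).smul_mem _ ((feat X₂).sum_mem fun i _ =>
      (feat X₂).add_mem ((feat X₂).smul_mem _ (hrot i 0).2) ((feat X₂).smul_mem _ (hrot i 1).2))
  have hkeyf : ∀ p, (fun w : List Sig => key (w.length / 2) p) ∈ feat X₂ := fun p =>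
    (feat X₂).smul_mem _ (hrot p.1 p.2.2).1
  obtain ⟨d, X, hX, hle', -, hrel⟩ := hX₂.exists_layer hK h1 (η := Unit) (φ := φ)
    (μ := Fin (n + 1) × Fin 4 × Fin 2)
    (fun _ w => if w.length % 2 = 0 then 2 / g else 0) (fun _ w => val (w.length / 2))
    (fun _ w => key (w.length / 2)) (fun _ w => key (w.length / 2))
    (fun _ w => st (w.length / 2 + 1))
    (fun _ => even_indicator_mem_feat h1 hpar _ _) (fun _ => hval) (fun _ => hval')
    (fun _ => hkeyf) (fun _ => hkeyf)
    (fun _ => by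
      have := hstep 0
      simpa [st] using this.symm)
    (fun _ w a => by
      have hlen : (w ++ [a]).length = w.length + 1 := by simp
      rw [hlen]
      rcases Nat.mod_two_eq_zero_or_one w.length with h | h
      · have h2 : (w.length + 1) % 2 = 1 := by omega
        have h3 : (w.length + 1) / 2 = w.length / 2 := by omega
        simp [h2, h3]
      · have h2 : (w.length + 1) % 2 = 0 := by omega
        have h3 : (w.length + 1) / 2 = w.length / 2 + 1 := by omega
        rw [h2, if_pos rfl, h3, hstep])
    -- The head outputs `val + g / 2 * e`; removing `val` and scaling by `4 / g` leaves `2 e`, to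
    -- which the parity adds the lowest bit. The memory advances every second position, whence the
    -- period `4 (n + 1)`.
    (fun i w => D * (if w.length % 2 = 0 then 0 else 1) + wordCode B dig w - θ i -
      D * (4 / g) * val (w.length / 2))
    (fun i => (feat X₂).sub_mem ((feat X₂).sub_mem ((feat X₂).add_mem
      ((feat X₂).smul_mem _ (even_indicator_mem_feat h1 hpar 0 1)) hcode) (by
        convert (feat X₂).smul_mem (θ i) h1 using 1
        ext w
        simp)) ((feat X₂).smul_mem _ hval))
    (fun _ _ => D * (4 / g))
  refine ⟨d, X, hX, hle' h1, fun i => ?_⟩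
  convert hrel i using 2 with w
  congr 1
  have hout : st (w.length / 2 + 1) ⬝ᵥ key (w.length / 2) =
      val (w.length / 2) + g / 2 * e (w.length / 2) := by
    have : st (w.length / 2 + 1) = st (w.length / 2) + e (w.length / 2) • key (w.length / 2) :=
      Finset.sum_range_succ _ _
    rw [this, add_dotProduct, smul_dotProduct, hst, hkey0, smul_eq_mul]
    ring
  have hmod : ((w.length % (4 * (n + 1)) : ℕ) : ℚ) =
      2 * e (w.length / 2) + if w.length % 2 = 0 then 0 else 1 := by
    have h1 : w.length % (4 * (n + 1)) = w.length % 2 + 2 * (w.length / 2 % (2 * (n + 1))) := by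
      rw [← Nat.mod_mul, ← mul_assoc, show 2 * 2 = 4 from rfl]
    rw [h1, Nat.cast_add, Nat.cast_mul]
    rcases Nat.mod_two_eq_zero_or_one w.length with h | h
    · rw [if_pos h, h]
      simp only [e]
      push_cast
      ring
    · rw [if_neg (by omega), h]
      simp only [e]
      push_cast
      ring
  simp only [Finset.univ_unique, Finset.sum_singleton, hout, hmod]
  field_simp
  ring

end PositionalLayers

/-! ### Decoding the position and the last letters -/

section Windows

variable {Sig : Type*}

/-- The last `N` letters of a word. -/
def lastLetters (N : ℕ) (w : List Sig) : List Sig := w.drop (w.length - N)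

theorem length_lastLetters (N : ℕ) (w : List Sig) : (lastLetters N w).length = min N w.length := by
  rw [lastLetters, List.length_drop]
  omega

theorem lastLetters_of_length_le {N : ℕ} {w : List Sig} (h : w.length ≤ N) : lastLetters N w = w := by
  rw [lastLetters, Nat.sub_eq_zero_of_le h, List.drop_zero]

theorem lastLetters_append {N : ℕ} (a b : List Sig) (h : N ≤ b.length) :
    lastLetters N (a ++ b) = lastLetters N b := by
  rw [lastLetters, lastLetters, List.length_append, Nat.add_sub_assoc h, List.drop_append]
  simp

theorem exists_append_lastLetters (N : ℕ) (w : List Sig) : ∃ a, w = a ++ lastLetters N w :=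
  ⟨w.take (w.length - N), (List.take_append_drop _ _).symm⟩

theorem lastLetters_lastLetters {N M : ℕ} (h : N ≤ M) (w : List Sig) :
    lastLetters N (lastLetters M w) = lastLetters N w := by
  rcases le_total w.length M with hw | hw
  · rw [lastLetters_of_length_le hw]
  · obtain ⟨a, ha⟩ := exists_append_lastLetters M w
    conv_rhs => rw [ha]
    rw [lastLetters_append]
    rw [length_lastLetters]
    omega

theorem lastLetters_succ_concat (N : ℕ) (w : List Sig) (a : Sig) :
    lastLetters (N + 1) (w ++ [a]) = lastLetters N w ++ [a] := by
  rw [lastLetters, lastLetters, List.length_append, List.length_singleton,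
    Nat.add_sub_add_right, List.drop_append_of_le_length (Nat.sub_le _ _)]

variable {κ : ℚ} {dig : Sig → ℚ}

theorem wordCode_mem_Icc (hκ : 0 ≤ κ) (hdig : ∀ a, 1 ≤ dig a ∧ dig a ≤ κ) (w : List Sig) :
    0 ≤ wordCode (8 * (κ + 1)) dig w ∧ wordCode (8 * (κ + 1)) dig w ≤ κ + 1 := by
  have hB : 0 < 8 * (κ + 1) := by positivity
  induction w using List.reverseRecOn with
  | nil => exact ⟨le_rfl, by rw [wordCode_nil]; positivity⟩
  | append_singleton w a ih =>
    rw [wordCode_concat]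
    have h1 : wordCode (8 * (κ + 1)) dig w / (8 * (κ + 1)) ≤ 1 := by
      rw [div_le_one hB]
      linarith [ih.2]
    have h2 : 0 ≤ wordCode (8 * (κ + 1)) dig w / (8 * (κ + 1)) := div_nonneg ih.1 hB.le
    constructor <;> linarith [hdig a]

/-- Everything older than `N` letters has been divided by the base `N` times, and a code is at most
`κ + 1`. -/
theorem abs_wordCode_sub_lastLetters_le (hκ : 0 ≤ κ) (hdig : ∀ a, 1 ≤ dig a ∧ dig a ≤ κ) (N : ℕ)
    (w : List Sig) : |wordCode (8 * (κ + 1)) dig w - wordCode (8 * (κ + 1)) dig (lastLetters N w)| ≤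
      (κ + 1) / (8 * (κ + 1)) ^ N := by
  have hB : 0 < 8 * (κ + 1) := by positivity
  induction w using List.reverseRecOn generalizing N with
  | nil =>
    rw [lastLetters_of_length_le (by simp), sub_self, abs_zero]
    positivity
  | append_singleton w a ih =>
    cases N with
    | zero =>
      have := wordCode_mem_Icc hκ hdig (w ++ [a])
      rw [show lastLetters 0 (w ++ [a]) = [] by simp [lastLetters], wordCode_nil, sub_zero, pow_zero,
        div_one, abs_of_nonneg this.1]
      exact this.2
    | succ N =>
      rw [lastLetters_succ_concat, wordCode_concat, wordCode_concat, add_sub_add_right_eq_sub,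
        ← sub_div, abs_div, abs_of_pos hB, pow_succ, ← div_div (κ + 1)]
      exact div_le_div_of_nonneg_right (ih N) hB.le

/-- Common last letters are stripped, at the cost of one factor of the base each. Then digits at
distance at least `1` face each other, with tails at most `1 / 8`, or a digit at least `1` faces the
empty word. Nonzero digits thus separate words of different lengths. -/
theorem le_abs_wordCode_sub (hκ : 0 ≤ κ) (hdig : ∀ a, 1 ≤ dig a ∧ dig a ≤ κ)
    (hsep : ∀ a b, a ≠ b → 1 ≤ |dig a - dig b|) (N : ℕ) (l l' : List Sig) (hl : l.length ≤ N)
    (hl' : l'.length ≤ N) (hne : l ≠ l') : 7 * ((κ + 1) / (8 * (κ + 1)) ^ N) ≤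
      |wordCode (8 * (κ + 1)) dig l - wordCode (8 * (κ + 1)) dig l'| := by
  have hB : 0 < 8 * (κ + 1) := by positivity
  have hB1 : 1 ≤ 8 * (κ + 1) := by linarith
  have hκ1 : κ + 1 ≠ 0 := by positivity
  have hsmall : ∀ N, 7 * ((κ + 1) / (8 * (κ + 1)) ^ (N + 1)) ≤ 7 / 8 := fun N => by
    have h1 : (κ + 1) / (8 * (κ + 1)) ^ (N + 1) ≤ (κ + 1) / (8 * (κ + 1)) :=
      div_le_div_of_nonneg_left (by positivity) hB (le_self_pow₀ hB1 (Nat.succ_ne_zero N))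
    have h2 : (κ + 1) / (8 * (κ + 1)) = 1 / 8 := by field_simp
    linarith
  induction N generalizing l l' with
  | zero =>
    exact absurd ((List.eq_nil_of_length_eq_zero (by omega)).trans
      (List.eq_nil_of_length_eq_zero (by omega)).symm) hne
  | succ N ih =>
    rcases l.eq_nil_or_concat' with rfl | ⟨l, a, rfl⟩ <;>
      rcases l'.eq_nil_or_concat' with rfl | ⟨l', b, rfl⟩
    · exact absurd rfl hne
    · rw [wordCode_nil, zero_sub, abs_neg, wordCode_concat]
      have h1 := div_nonneg (wordCode_mem_Icc hκ hdig l').1 hB.le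
      refine (hsmall N).trans (le_trans ?_ (le_abs_self _))
      linarith [hdig b]
    · rw [wordCode_nil, sub_zero, wordCode_concat]
      have h1 := div_nonneg (wordCode_mem_Icc hκ hdig l).1 hB.le
      refine (hsmall N).trans (le_trans ?_ (le_abs_self _))
      linarith [hdig a]
    · rw [wordCode_concat, wordCode_concat]
      simp only [List.length_append, List.length_singleton] at hl hl'
      by_cases hab : a = b
      · subst hab
        rw [add_sub_add_right_eq_sub, ← sub_div, abs_div, abs_of_pos hB, pow_succ, ← div_div (κ + 1),
          ← mul_div_assoc]
        exact div_le_div_of_nonneg_right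
          (ih l l' (by omega) (by omega) fun h => hne (by rw [h])) hB.le
      · refine (hsmall N).trans ?_
        have h1 : ∀ u : List Sig, 0 ≤ wordCode (8 * (κ + 1)) dig u / (8 * (κ + 1)) ∧
            wordCode (8 * (κ + 1)) dig u / (8 * (κ + 1)) ≤ 1 / 8 := fun u => by
          refine ⟨div_nonneg (wordCode_mem_Icc hκ hdig u).1 hB.le, ?_⟩
          rw [div_le_iff₀ hB]
          linarith [(wordCode_mem_Icc hκ hdig u).2]
        have h2 := h1 l
        have h3 := h1 l'
        rcases le_abs.1 (hsep a b hab) with h | h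
        · refine le_trans ?_ (le_abs_self _)
          linarith
        · refine le_trans ?_ (neg_le_abs _)
          linarith

/-- The trapezoid with plateau `[a - δ, a + δ]` and support `[a - 2 δ, a + 2 δ]`. -/
theorem trapezoid_eq {δ : ℚ} (hδ : 0 < δ) (a x : ℚ) (hx : |x - a| ≤ δ ∨ 2 * δ ≤ |x - a|) :
    (1 / δ) * (max (x - (a - 2 * δ)) 0 - max (x - (a - δ)) 0 - max (x - (a + δ)) 0 +
      max (x - (a + 2 * δ)) 0) = if |x - a| ≤ δ then 1 else 0 := by
  split_ifs with h
  · obtain ⟨h1, h2⟩ := abs_le.1 h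
    rw [max_eq_left (by linarith), max_eq_left (by linarith), max_eq_right (by linarith),
      max_eq_right (by linarith)]
    field_simp
    ring
  · rcases le_abs.1 (hx.resolve_left h) with h1 | h1
    · rw [max_eq_left (by linarith), max_eq_left (by linarith), max_eq_left (by linarith),
        max_eq_left (by linarith)]
      ring
    · rw [max_eq_right (by linarith), max_eq_right (by linarith), max_eq_right (by linarith),
        max_eq_right (by linarith)]
      ring

variable {K : ∀ {d m : ℕ}, LRNNHead d m → Prop}

/-- Three layers compute every function of the position modulo `4 (n + 1)` and of the last `N`
letters. -/
theorem exists_window_layers [Fintype Sig] (hK : IsDeltaClass K) (n N : ℕ) :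
    ∃ (d : ℕ) (X : List Sig → Fin d → ℚ), Realizable K 3 d X ∧
      ∀ g : ℕ → List Sig → ℚ,
        (fun w : List Sig => g (w.length % (4 * (n + 1))) (lastLetters N w)) ∈ feat X := by
  classical
  let κ : ℚ := Fintype.card Sig
  have hκ : 0 ≤ κ := Nat.cast_nonneg _
  let dig : Sig → ℚ := fun a => ((Fintype.equivFin Sig a : ℕ) : ℚ) + 1
  have hdig : ∀ a, 1 ≤ dig a ∧ dig a ≤ κ := fun a => by
    refine ⟨le_add_of_nonneg_left (Nat.cast_nonneg _), ?_⟩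
    have h := Nat.succ_le_of_lt (Fintype.equivFin Sig a).2
    simp only [dig, κ]
    exact_mod_cast h
  have hsep : ∀ a b, a ≠ b → 1 ≤ |dig a - dig b| := fun a b hab => by
    have h1 : ((Fintype.equivFin Sig a : ℕ) : ℤ) ≠ (Fintype.equivFin Sig b : ℕ) := by
      exact_mod_cast fun h => hab ((Fintype.equivFin Sig).injective (Fin.ext h))
    have h2 := Int.one_le_abs (sub_ne_zero.2 h1)
    simp only [dig, add_sub_add_right_eq_sub]
    exact_mod_cast h2
  let B : ℚ := 8 * (κ + 1)
  have hB : 1 < B := by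
    simp only [B]
    linarith
  let δ : ℚ := (κ + 1) / B ^ N
  have hδ : 0 < δ := by positivity
  have hδκ : δ ≤ κ + 1 := div_le_self (by positivity) (one_le_pow₀ hB.le)
  -- Codes lie in `[0, κ + 1]`, so distinct residues stay at least `3 (κ + 1) ≥ 3 δ` apart.
  let D : ℚ := 4 * (κ + 1)
  have : Finite {l : List Sig // l.length ≤ N} := (List.finite_length_le Sig N).to_subtype
  have : Fintype {l : List Sig // l.length ≤ N} := Fintype.ofFinite _
  let Z := Fin (4 * (n + 1)) × {l : List Sig // l.length ≤ N}
  let z : List Sig → Z := fun w => (⟨w.length % (4 * (n + 1)), Nat.mod_lt _ (by omega)⟩,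
    ⟨lastLetters N w, by rw [length_lastLetters]; exact min_le_left _ _⟩)
  let center : Z → ℚ := fun ζ => D * ((ζ.1 : ℕ) : ℚ) + wordCode B dig ζ.2
  let x : List Sig → ℚ := fun w =>
    D * ((w.length % (4 * (n + 1)) : ℕ) : ℚ) + wordCode B dig w
  have hnear : ∀ w, |x w - center (z w)| ≤ δ := fun w => by
    simp only [x, center, z, add_sub_add_left_eq_sub]
    exact abs_wordCode_sub_lastLetters_le hκ hdig N w
  have hfar : ∀ ζ ζ' : Z, ζ ≠ ζ' → 3 * δ ≤ |center ζ - center ζ'| := fun ζ ζ' hne => by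
    obtain ⟨i, l⟩ := ζ
    obtain ⟨i', l'⟩ := ζ'
    by_cases hi : i = i'
    · subst hi
      have hl : l.1 ≠ l'.1 := fun h => hne (by rw [Subtype.ext h])
      simp only [center, add_sub_add_left_eq_sub]
      have h7 : 7 * δ ≤ |wordCode B dig l.1 - wordCode B dig l'.1| :=
        le_abs_wordCode_sub hκ hdig hsep N l.1 l'.1 l.2 l'.2 hl
      linarith
    · have h1 : ((i : ℕ) : ℤ) - (i' : ℕ) ≠ 0 := by
        rw [sub_ne_zero]
        exact_mod_cast fun h => hi (Fin.ext h)
      have h2 : (1 : ℚ) ≤ |((i : ℕ) : ℚ) - (i' : ℕ)| := by exact_mod_cast Int.one_le_abs h1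
      have h3 : 0 ≤ wordCode B dig l.1 ∧ wordCode B dig l.1 ≤ κ + 1 := wordCode_mem_Icc hκ hdig l.1
      have h4 : 0 ≤ wordCode B dig l'.1 ∧ wordCode B dig l'.1 ≤ κ + 1 :=
        wordCode_mem_Icc hκ hdig l'.1
      simp only [center]
      rcases le_abs.1 h2 with h | h
      · refine le_trans ?_ (le_abs_self _)
        nlinarith
      · refine le_trans ?_ (neg_le_abs _)
        nlinarith
  obtain ⟨d, X, hX, -, hrel⟩ := exists_counter_layers hK n B hB dig D
    (fun p : Z × Fin 4 => center p.1 + ![-2 * δ, -δ, δ, 2 * δ] p.2)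
  refine ⟨d, X, hX, fun g => ?_⟩
  -- The observed value is within `δ` of its own center and, centers being `3 δ` apart, at least `2
  -- δ` from all others. The slopes of the trapezoid are never met.
  have htrap : ∀ ζ : Z, (fun w => if z w = ζ then (1 : ℚ) else 0) ∈ feat X := fun ζ => by
    have h := (feat X).smul_mem (1 / δ) ((feat X).add_mem ((feat X).sub_mem ((feat X).sub_mem
      (hrel (ζ, 0)) (hrel (ζ, 1))) (hrel (ζ, 2))) (hrel (ζ, 3)))
    convert h using 1
    ext w
    have hx : |x w - center ζ| ≤ δ ↔ z w = ζ := by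
      constructor
      · intro h
        by_contra hne
        have h1 := hfar _ _ hne
        have h2 := abs_sub_le (center (z w)) (x w) (center ζ)
        rw [abs_sub_comm] at h2
        have h3 := hnear w
        have h4 := abs_sub_comm (center (z w)) (x w)
        rw [abs_sub_comm (center ζ)] at h2
        linarith
      · rintro rfl
        exact hnear w
    have hx' : |x w - center ζ| ≤ δ ∨ 2 * δ ≤ |x w - center ζ| := by
      by_cases hz : z w = ζ
      · exact Or.inl (hx.2 hz)
      · right
        have h1 := hfar _ _ hz
        have h2 := abs_sub_le (center (z w)) (x w) (center ζ)
        have h3 := hnear w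
        rw [abs_sub_comm (center (z w)) (x w)] at h2
        linarith
    have ht := trapezoid_eq hδ (center ζ) (x w) hx'
    simp only [hx] at ht
    rw [← ht]
    change _ = 1 / δ * (max (x w - (center ζ + -2 * δ)) 0 - max (x w - (center ζ + -δ)) 0 -
      max (x w - (center ζ + δ)) 0 + max (x w - (center ζ + 2 * δ)) 0)
    rw [neg_mul, ← sub_eq_add_neg, ← sub_eq_add_neg]
  have hg : (fun w : List Sig => g (w.length % (4 * (n + 1))) (lastLetters N w)) =
      ∑ ζ : Z, g ζ.1 ζ.2 • fun w => if z w = ζ then (1 : ℚ) else 0 := by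
    ext w
    simp only [Finset.sum_apply, Pi.smul_apply, smul_eq_mul, mul_ite, mul_one, mul_zero]
    symm
    rw [Finset.sum_eq_single (z w)]
    · exact if_pos rfl
    · intro ζ _ h
      exact if_neg (Ne.symm h)
    · intro h
      exact absurd (Finset.mem_univ _) h
  rw [hg]
  exact (feat X).sum_mem fun ζ _ => (feat X).smul_mem _ (htrap ζ)

end Windows

/-! ### Blockwise simulation of the automaton -/

section Simulation

variable {Sig : Type*} {n : ℕ}

/-- The product of the transition matrices along a word. -/
def WFA.wordMatrix (A : WFA Sig n) (w : List Sig) : Matrix (Fin n) (Fin n) ℚ := (w.map A.M).prod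

theorem WFA.wordMatrix_append (A : WFA Sig n) (u v : List Sig) :
    A.wordMatrix (u ++ v) = A.wordMatrix u * A.wordMatrix v := by
  simp [WFA.wordMatrix]

/-- The part of a word before its current block of length `L`, where position `0` is occupied by
the beginning-of-sequence token. -/
def beforeBlock (L : ℕ) (w : List Sig) : List Sig := w.take (w.length - (w.length % L + 1))

/-- The part of a word in its current block of length `L`. -/
def currentBlock (L : ℕ) (w : List Sig) : List Sig := lastLetters (w.length % L + 1) w

theorem beforeBlock_append_currentBlock (L : ℕ) (w : List Sig) :
    beforeBlock L w ++ currentBlock L w = w := List.take_append_drop _ _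

/-- The current block has at most `L` letters and the preceding one `L` more, so a window of `2 L`
letters shows both. -/
theorem lastLetters_take_lastLetters {L N s : ℕ} (hs : s ≤ L) (hN : 2 * L ≤ N) (w : List Sig) :
    lastLetters L ((lastLetters N w).take ((lastLetters N w).length - s)) =
      lastLetters L (w.take (w.length - s)) := by
  rcases le_total w.length N with hw | hw
  · rw [lastLetters_of_length_le hw]
  · obtain ⟨a, ha⟩ := exists_append_lastLetters N w
    have hlen : (lastLetters N w).length = N := by
      rw [length_lastLetters]
      omega
    generalize lastLetters N w = l at *
    subst ha
    rw [List.take_append, List.length_append, List.take_of_length_le (l := a) (by omega),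
      lastLetters_append _ _ (by rw [List.length_take]; omega)]
    congr 2
    omega

theorem beforeBlock_concat_of_lt {L : ℕ} {w : List Sig} (a : Sig) (h : w.length % L + 1 < L) :
    (w ++ [a]).length % L = w.length % L + 1 ∧ beforeBlock L (w ++ [a]) = beforeBlock L w := by
  have h1 : (w ++ [a]).length % L = w.length % L + 1 := by
    rw [List.length_append, List.length_singleton, ← Nat.mod_add_mod, Nat.mod_eq_of_lt h]
  refine ⟨h1, ?_⟩
  rw [beforeBlock, h1, beforeBlock, List.length_append, List.length_singleton,
    Nat.add_sub_add_right, List.take_append_of_le_length (Nat.sub_le _ _)]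

theorem beforeBlock_concat_of_eq {L : ℕ} {w : List Sig} (a : Sig) (h : w.length % L + 1 = L) :
    (w ++ [a]).length % L = 0 ∧ beforeBlock L (w ++ [a]) = w := by
  have h1 : (w ++ [a]).length % L = 0 := by
    rw [List.length_append, List.length_singleton, ← Nat.mod_add_mod, h, Nat.mod_self]
  refine ⟨h1, ?_⟩
  rw [beforeBlock, h1, List.length_append, List.length_singleton, zero_add, Nat.add_sub_cancel,
    List.take_left]

theorem exists_recurrence {β : Type*} (b : β) (step : List Sig → β → β) :
    ∃ s : List Sig → β, s [] = b ∧ ∀ w a, s (w ++ [a]) = step (w ++ [a]) (s w) :=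
  ⟨fun w => w.reverseRecOn b fun w a ih => step (w ++ [a]) ih, List.reverseRecOn_nil _ _,
    fun _ _ => List.reverseRecOn_concat _ _ _ _⟩

variable {K : ∀ {d m : ℕ}, LRNNHead d m → Prop}

/-- If every function of the position modulo `L` and of the last `2 L` letters is available, then
one more layer simulates an `n`-state weighted automaton, provided that `6 n ≤ L`. -/
theorem exists_simulation_layer (hK : IsDeltaClass K) (A : WFA Sig n) {ℓ d : ℕ}
    {X : List Sig → Fin d → ℚ} (hX : Realizable K ℓ d X) {L : ℕ} (hL0 : 0 < L) (hL : 6 * n ≤ L)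
    (hg : ∀ g : ℕ → List Sig → ℚ,
      (fun w : List Sig => g (w.length % L) (lastLetters (2 * L) w)) ∈ feat X) :
    ∃ (d' : ℕ) (X' : List Sig → Fin d' → ℚ), Realizable K (ℓ + 1) d' X' ∧
      A.weight ∈ feat X' := by
  have h1 : (fun _ => 1) ∈ feat X := hg fun _ _ => 1
  -- A memory needs a nonempty index type; without states the weight is zero.
  rcases Nat.eq_zero_or_pos n with rfl | hn
  · obtain ⟨d', X', hX', -⟩ := hX.exists_layer hK h1 (η := Empty) (φ := Empty) (μ := Unit)
      Empty.elim Empty.elim Empty.elim Empty.elim Empty.elim (fun j => j.elim) (fun j => j.elim)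
      (fun j => j.elim) (fun j => j.elim) (fun j => j.elim) (fun j => j.elim) (fun j => j.elim)
      Empty.elim (fun j => j.elim) Empty.elim
    refine ⟨d', X', hX', ?_⟩
    convert (feat X').zero_mem using 1
    ext w
    simp [WFA.weight_eq, dotProduct]
  have : Nonempty (Fin n ⊕ Fin n) := ⟨Sum.inl ⟨0, hn⟩⟩
  -- The last argument `min 1 w.length` singles out position `0`, which the residue alone does not.
  have hfeat : ∀ G : ℕ → List Sig → List Sig → ℕ → ℚ,
      (fun w => G (w.length % L) (lastLetters L (beforeBlock L w)) (currentBlock L w)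
        (min 1 w.length)) ∈ feat X := fun G => by
    convert hg fun i l => G i (lastLetters L (l.take (l.length - (i + 1)))) (lastLetters (i + 1) l)
      (min 1 l.length) using 2 with w
    have hmod := Nat.mod_lt w.length hL0
    rw [lastLetters_take_lastLetters (by omega) le_rfl, lastLetters_lastLetters (by omega),
      length_lastLetters, ← min_assoc, min_eq_left (by omega : 1 ≤ 2 * L)]
    rfl
  choose fac hlen hfac using fun P : Matrix (Fin n) (Fin n) ℚ =>
    exists_deltaProd_factorization P L hL
  let opsOf : List Sig → List (ℚ × (Fin n ⊕ Fin n → ℚ)) := fun l => fac (A.wordMatrix l)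
  let ops : List Sig → List (ℚ × (Fin n ⊕ Fin n → ℚ)) := fun w =>
    opsOf (lastLetters L (beforeBlock L w))
  let op : List Sig → ℚ × (Fin n ⊕ Fin n → ℚ) := fun w => (ops w).getD (w.length % L) (0, 0)
  -- At position `0` the state is zero and the transition has no effect, so the vector that the
  -- first factor would have produced is written with gain and value `1`. The block before the first
  -- one is empty, and its factors fix `[α | α]`.
  let init : Fin n ⊕ Fin n → ℚ := Sum.elim A.α A.α ᵥ* deltaTransition (op []).1 (op []).2
  let β : List Sig → ℚ := fun w => if min 1 w.length = 0 then 1 else (op w).1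
  let v : List Sig → ℚ := fun w => if min 1 w.length = 0 then 1 else 0
  let k : List Sig → Fin n ⊕ Fin n → ℚ := fun w => if min 1 w.length = 0 then init else (op w).2
  -- The factor of the current position is already in the state, hence the offset `+ 1`. The query
  -- completes the pending factors and then applies the current block.
  let q : List Sig → Fin n ⊕ Fin n → ℚ := fun w => deltaProd ((ops w).drop (w.length % L + 1)) *ᵥ
    Sum.elim (A.wordMatrix (currentBlock L w) *ᵥ A.ω) 0
  obtain ⟨s, hs0, hs⟩ := exists_recurrence init fun (w : List Sig) s =>
    s + (β w * (v w - s ⬝ᵥ k w)) • k w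
  have hops : ∀ w, op w :: (ops w).drop (w.length % L + 1) = (ops w).drop (w.length % L) := fun w => by
    have hlt : w.length % L < (ops w).length := by
      rw [hlen]
      exact Nat.mod_lt _ hL0
    rw [List.drop_eq_getElem_cons hlt]
    simp only [op, List.getD_eq_getElem _ _ hlt]
  have hinv : ∀ w, s w ᵥ* deltaProd ((ops w).drop (w.length % L + 1)) =
      Sum.elim (A.α ᵥ* A.wordMatrix (beforeBlock L w)) (A.α ᵥ* A.wordMatrix (beforeBlock L w)) := by
    intro w
    induction w using List.reverseRecOn with
    | nil =>
      rw [hs0, vecMul_vecMul, ← deltaProd_cons, hops]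
      simp only [List.length_nil, Nat.zero_mod, List.drop_zero, ops, opsOf, hfac]
      simp [lastLetters, beforeBlock, WFA.wordMatrix]
    | append_singleton w a ih =>
      have hstep : s (w ++ [a]) = s w ᵥ* deltaTransition (op (w ++ [a])).1 (op (w ++ [a])).2 := by
        have hne : min 1 (w ++ [a]).length ≠ 0 := by simp
        rw [hs, vecMul_deltaTransition]
        simp only [β, v, k, if_neg hne, zero_sub, mul_neg, neg_smul, ← sub_eq_add_neg]
      rw [hstep, vecMul_vecMul, ← deltaProd_cons, hops]
      have hmod := Nat.mod_lt w.length hL0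
      rcases lt_or_eq_of_le (show w.length % L + 1 ≤ L from hmod) with h | h
      · obtain ⟨h2, h3⟩ := beforeBlock_concat_of_lt a h
        simp only [ops] at ih ⊢
        rw [h2, h3, ih]
      -- At a boundary no factor is pending, and the block just closed becomes the matrix to be
      -- factored next.
      · obtain ⟨h2, h3⟩ := beforeBlock_concat_of_eq a h
        have hcur : currentBlock L w = lastLetters L w := by rw [currentBlock, h]
        have hdrop : (ops w).drop (w.length % L + 1) = [] :=
          List.drop_eq_nil_of_le (by rw [hlen]; exact h.ge)
        rw [hdrop, deltaProd_nil, vecMul_one] at ih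
        simp only [ops] at ih ⊢
        rw [h2, h3, List.drop_zero, ih, hfac, ← hcur, vecMul_vecMul, ← WFA.wordMatrix_append,
          beforeBlock_append_currentBlock]
  obtain ⟨d', X', hX', -, hout, -⟩ := hX.exists_layer hK h1 (η := Unit) (φ := Empty)
    (μ := Fin n ⊕ Fin n) (fun _ => β) (fun _ => v) (fun _ => k) (fun _ => q) (fun _ => s)
    (fun _ => hfeat fun i l _ t => if t = 0 then 1 else ((opsOf l).getD i (0, 0)).1)
    (fun _ => hfeat fun _ _ _ t => if t = 0 then 1 else 0)
    (fun _ => by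
      convert hfeat fun _ _ _ t => if t = 0 then 1 else 0 using 2 with w
      by_cases h : min 1 w.length = 0 <;> simp only [β, v, h, if_true, if_false, mul_one, mul_zero])
    (fun _ j => by
      convert hfeat fun i l _ t => if t = 0 then init j else ((opsOf l).getD i (0, 0)).2 j using 2
        with w
      by_cases h : min 1 w.length = 0 <;> simp only [k, op, ops, h, if_true, if_false])
    (fun _ j => hfeat fun i l c _ => (deltaProd ((opsOf l).drop (i + 1)) *ᵥ
      Sum.elim (A.wordMatrix c *ᵥ A.ω) 0) j)
    (fun _ => by simp [hs0, β, v, k])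
    (fun _ w a => hs w a)
    Empty.elim (fun i => i.elim) Empty.elim
  refine ⟨d', X', hX', ?_⟩
  convert hout () using 1
  ext w
  rw [dotProduct_mulVec, hinv, WFA.weight_eq, sumElim_dotProduct_sumElim, dotProduct_zero, add_zero,
    ← dotProduct_mulVec, mulVec_mulVec, ← WFA.wordMatrix_append, beforeBlock_append_currentBlock]
  rfl

/-- Every class of heads that contains the delta rule has a four-layer network that computes the
weight of every prefix. -/
theorem exists_network_weight [Fintype Sig] (hK : IsDeltaClass K) (A : WFA Sig n) :
    ∃ N : LRNNNetwork Sig 4, (∀ i j, K ((N.layer i).head j)) ∧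
      ∀ (w : List Sig) (t : Fin (w.length + 1)), N.output w t = A.weight (w.take t) := by
  -- The counter parameter `2 n` gives the period `L = 4 (2 n + 1) ≥ 6 n`, and the window has length
  -- `2 L`.
  obtain ⟨d, X, hX, hg⟩ := exists_window_layers (Sig := Sig) hK (2 * n) (2 * (4 * (2 * n + 1)))
  obtain ⟨d', X', hX', hA⟩ := exists_simulation_layer hK A hX (by omega) (by omega) hg
  exact hX'.exists_network hA

end Simulation

theorem theorem5 {Sig : Type*} [Fintype Sig] (n : ℕ) (A : WFA Sig n) :
    (∃ N : LRNNNetwork Sig 4, N.IsRWKV7 ∧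
      ∀ (w : List Sig) (t : Fin (w.length + 1)), N.output w t = A.weight (w.take t)) ∧
    (∃ N : LRNNNetwork Sig 4, N.IsDeltaNet ∧
      ∀ (w : List Sig) (t : Fin (w.length + 1)), N.output w t = A.weight (w.take t)) ∧
    (∀ P : Matrix (Fin n) (Fin n) ℚ,
      ∃ G : Fin (2 * n) → Matrix (Fin n ⊕ Fin n) (Fin n ⊕ Fin n) ℚ,
        (∀ i, IsOverwrite (G i)) ∧
        ∀ x s : Fin n → ℚ,
          Sum.elim x s ᵥ* (List.ofFn G).prod = Sum.elim (x ᵥ* P) (x ᵥ* P)) ∧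
    (∀ P : Matrix (Fin n) (Fin n) ℚ,
      ∃ (β : Fin (8 * n ^ 2 + 5 * n + 1) → ℚ)
        (k : Fin (8 * n ^ 2 + 5 * n + 1) → (Fin n ⊕ Fin n ⊕ Fin 1) → ℚ),
        ∀ (x s : Fin n → ℚ) (r : Fin 1 → ℚ),
          Sum.elim x (Sum.elim s r) ᵥ*
              (List.ofFn fun i => deltaTransition (β i) (k i)).prod =
            Sum.elim (x ᵥ* P) (Sum.elim (x ᵥ* P) 0)) :=
  ⟨exists_network_weight isDeltaClass_isRWKV7 A, exists_network_weight isDeltaClass_isDeltaNet A,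
    exists_isOverwrite_factorization,
    -- Only `6 n + 1` factors are needed, and `n ≤ n ^ 2` gives `6 n + 1 ≤ 8 n ^ 2 + 5 n + 1`.
    fun P => exists_deltaTransition_factorization P _ (by nlinarith [Nat.le_self_pow two_ne_zero n])⟩
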